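/- **Setting.** Let $V$ be a finite set of qubits. For a simple graph $G=(V,E)$, let $|G\rangle=\bigl(\prod_{\{u,v\}\in E}\Lambda Z_{uv}\bigr)\bigl(\prod_{v\in V}H_v\bigr)|0\rangle^{\otimes V}$ be its graph state; it is, up to a scalar, the only vector with $X_v\prod_{u\in\operatorname{ngbh}v}Z_u\,|G\rangle=|G\rangle$ for all $v\in V$. Here $\operatorname{ngbh}v$ is the set of neighbours of $v$, and $\Lambda Z_{uv}$ is the controlled phase gate, diagonal with entry $-1$ exactly where both qubits are $1$. Let $\mathcal C_1$ be the group of one-qubit unitaries that normalize the Pauli group $\{\pm1,\pm i\}\cdot\{I,X,Y,Z\}$. For $C_v\in\mathcal C_1$ $(v\in V)$ put $|G;C\rangle=\bigotimes_v C_v\,|G\rangle$. The $C_v$ are called vertex operators (VOPs). They are considered modulo global phases, so that $|G;C\rangle$ is defined up to a global phase, and equalities between VOPs are meant modulo phases. A pair $(G,C)$ *represents* a vector $\psi$ if $\psi=z\,|G;C\rangle$ with $|z|=1$. Let $S=\operatorname{diag}(1,i)$, $\mathcal Z=\{I,Z,S,S^\dagger\}$, $\sqrt{\pm iX}=(I\pm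 iX)/\sqrt2$, $\sqrt{\pm iZ}=(I\pm iZ)/\sqrt2$. *Local complementation* about $v$ replaces $E$ by $E\vartriangle\{\{u,w\}: u\ne w,\ u,w\in\operatorname{ngbh}v\}$, $C_v$ by $C_v\sqrt{iX}$, and $C_u$ by $C_u\sqrt{-iZ}$ for every $u\in\operatorname{ngbh}v$ (neighbourhood before the operation). A *decomposition table* assigns to each $C\in\mathcal C_1$ (modulo phase) a word of length at most $5$ in the letters $\sqrt{-iX},\sqrt{iZ}$ whose product is $C$ up to a phase. *Reducing* vertex $a$ with swapping partner $c$ means: read the word of $C_a$ from right to left, doing a local complementation about $a$ for each letter $\sqrt{-iX}$ and about $c$ for each letter $\sqrt{iZ}$. A *phase table* is a map $(\zeta,C_1,C_2)\mapsto(\zeta',C_1',C_2')$ with $\zeta,\zeta'\in\{0,1\}$ and VOPs $C_i,C_i'$ such that, for the two-vertex graphs $G_0$ (no edge) and $G_1$ (one edge), $\Lambda Z_{12}|G_\zeta;C_1,C_2\rangle=z\,|G_{\zeta'};C'_1,C'_2\rangle$ with $|z|=1$. It satisfies *Constraint 1* if always $C_1\in\mathcal Z\Rightarrow C_1'\in\mathcal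 Z$ and $C_2\in\mathcal Z\Rightarrow C_2'\in\mathcal Z$. *Looking up* $\{a,b\}$ replaces the presence bit $\zeta$ of the edge $\{a,b\}$ together with $C_a,C_b$ by the table's value at $(\zeta,C_a,C_b)$ and leaves the rest unchanged. The procedure $\mathtt{cphase}(a,b)$ on $(G,C)$ is: (1) if $\operatorname{ngbh}a\setminus\{b\}\neq\emptyset$, reduce $a$ with an arbitrarily chosen swapping partner in $\operatorname{ngbh}a\setminus\{b\}$; (2) if now $\operatorname{ngbh}b\setminus\{a\}\neq\emptyset$, reduce $b$ with an arbitrarily chosen swapping partner in $\operatorname{ngbh}b\setminus\{a\}$; (3) repeat step (1); (4) look up $\{a,b\}$ in the phase table. **Theorem.** Decomposition tables exist, and phase tables satisfying Constraint 1 exist. Fix any of each. Let $V$ be finite, $a\neq b$ in $V$, and let $(G,C)$ represent $\psi$. Then: 1. If $C_a,C_b\in\mathcal Z$, toggling the edge $\{a,b\}$ (and keeping $C$) gives a pair that represents $\Lambda Z_{ab}\psi$. 2. If $c\in\operatorname{ngbh}a$, then reducing $a$ with swapping partner $c$ uses at most $5$ local complementations; the resulting pair still represents $\psi$, has VOP $I$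 at $a$, and still has the edge $\{a,c\}$; the VOP of each vertex other than $a,c$ has only been right-multiplied by an element of $\mathcal Z$. 3. If $a$ is reduced with a partner $c\in\operatorname{ngbh}a\setminus\{b\}$ and then $b$ with a partner $d\in\operatorname{ngbh}b\setminus\{a\}$ (neighbourhood after the first reduction), then the VOP of $a$ is in $\mathcal Z$, that of $b$ is $I$, and toggling the edge $\{a,b\}$ now gives a pair that represents $\Lambda Z_{ab}\psi$. 4. If ($\operatorname{ngbh}a\subseteq\{b\}$ or $C_a\in\mathcal Z$) and ($\operatorname{ngbh}b\subseteq\{a\}$ or $C_b\in\mathcal Z$), then looking up $\{a,b\}$ in the phase table gives a pair that represents $\Lambda Z_{ab}\psi$. 5. The procedure $\mathtt{cphase}(a,b)$ can be carried out. For all choices of swapping partners, the pair obtained after steps (1)–(3) still represents $\psi$ and satisfies the hypothesis of 4, and the final pair represents $\Lambda Z_{ab}\psi$. -/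

import Mathlib

open scoped symmDiff

noncomputable section

/-! ### Single-qubit matrices, the Pauli group and the local Clifford group -/

/-- `2 × 2` complex matrices, i.e. operators on one qubit. -/
abbrev QMat := Matrix (Fin 2) (Fin 2) ℂ

def pauliX : QMat := !![0, 1; 1, 0]

def pauliY : QMat := !![0, -Complex.I; Complex.I, 0]

def pauliZ : QMat := !![1, 0; 0, -1]

def hadamardMat : QMat := ((Real.sqrt 2 : ℝ) : ℂ)⁻¹ • !![1, 1; 1, -1]

def phaseMat : QMat := !![1, 0; 0, Complex.I]

/-- `√(iX) = exp(iπX/4) = (I + iX)/√2`. -/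
def sqrtIXMat : QMat := ((Real.sqrt 2 : ℝ) : ℂ)⁻¹ • (1 + Complex.I • pauliX)

/-- `√(-iZ) = exp(-iπZ/4) = (I - iZ)/√2`, which is `exp(-iπ/4) S`. -/
def sqrtNegIZMat : QMat := ((Real.sqrt 2 : ℝ) : ℂ)⁻¹ • (1 - Complex.I • pauliZ)

/-- The one-qubit Pauli group `{±1, ±i} · {I, X, Y, Z}`. -/
def pauliGroup : Set (Matrix.unitaryGroup (Fin 2) ℂ) :=
  {P | ∃ c ∈ ({1, -1, Complex.I, -Complex.I} : Set ℂ),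
    ∃ σ ∈ ({1, pauliX, pauliY, pauliZ} : Set QMat), (P : QMat) = c • σ}

/-- The one-qubit Clifford operators: the unitaries that normalize the Pauli group. -/
def cliffordOps : Subgroup (Matrix.unitaryGroup (Fin 2) ℂ) :=
  Subgroup.normalizer pauliGroup

/-- The Clifford operators that are a mere global phase. -/
def globalPhases : Subgroup cliffordOps where
  carrier := {U | ∃ z : ℂ, ((U : Matrix.unitaryGroup (Fin 2) ℂ) : QMat) = z • 1}
  one_mem' := ⟨1, by simp⟩
  mul_mem' := by
    rintro U W ⟨z, hz⟩ ⟨w, hw⟩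
    exact ⟨z * w, by simp [hz, hw, smul_smul, mul_comm]⟩
  inv_mem' := by
    rintro U ⟨z, hz⟩
    refine ⟨star z, ?_⟩
    have : (((U⁻¹ : cliffordOps) : Matrix.unitaryGroup (Fin 2) ℂ) : QMat)
        = star ((U : Matrix.unitaryGroup (Fin 2) ℂ) : QMat) := rfl
    rw [this, hz, star_smul, star_one]

instance globalPhases_normal : globalPhases.Normal where
  conj_mem := by
    rintro U ⟨z, hz⟩ W
    refine ⟨z, ?_⟩
    have h1 : (((W * U * W⁻¹ : cliffordOps) : Matrix.unitaryGroup (Fin 2) ℂ) : QMat)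
        = ((W : Matrix.unitaryGroup (Fin 2) ℂ) : QMat)
          * ((U : Matrix.unitaryGroup (Fin 2) ℂ) : QMat)
          * (((W⁻¹ : cliffordOps) : Matrix.unitaryGroup (Fin 2) ℂ) : QMat) := rfl
    rw [h1, hz]
    simp

/-- The local Clifford group with global phases disregarded (24 elements);
vertex operators are elements of this group. -/
abbrev LocalClifford := cliffordOps ⧸ globalPhases

/-- The class modulo global phase of a Clifford operator. -/
def cliffordClass (U : cliffordOps) : LocalClifford := QuotientGroup.mk U

/-- The `2 × 2` matrix of a Clifford operator. -/
def cliffordMat (U : cliffordOps) : QMat := ((U : Matrix.unitaryGroup (Fin 2) ℂ) : QMat)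

/-- A unitary is Clifford if conjugation by it and by its inverse sends each of `X, Y, Z` to
plus or minus one of `X, Y, Z`. -/
theorem mem_cliffordOps_of_conj (U : Matrix.unitaryGroup (Fin 2) ℂ)
    (h : ∀ σ ∈ ({pauliX, pauliY, pauliZ} : Set QMat),
      ∃ τ ∈ ({pauliX, pauliY, pauliZ} : Set QMat),
        (U : QMat) * σ * star (U : QMat) = τ ∨ (U : QMat) * σ * star (U : QMat) = -τ)
    (h' : ∀ σ ∈ ({pauliX, pauliY, pauliZ} : Set QMat),
      ∃ τ ∈ ({pauliX, pauliY, pauliZ} : Set QMat),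
        star (U : QMat) * σ * (U : QMat) = τ ∨ star (U : QMat) * σ * (U : QMat) = -τ) :
    U ∈ cliffordOps := by
  have hU : (U : QMat) * star (U : QMat) = 1 := Matrix.mem_unitaryGroup_iff.1 U.2
  have hU' : star (U : QMat) * (U : QMat) = 1 := Matrix.UnitaryGroup.star_mul_self U
  have neg : ∀ c ∈ ({1, -1, Complex.I, -Complex.I} : Set ℂ),
      -c ∈ ({1, -1, Complex.I, -Complex.I} : Set ℂ) := by
    rintro c (rfl | rfl | rfl | rfl) <;> simp
  have key : ∀ A B : QMat, A * B = 1 →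
      (∀ σ ∈ ({pauliX, pauliY, pauliZ} : Set QMat),
        ∃ τ ∈ ({pauliX, pauliY, pauliZ} : Set QMat), A * σ * B = τ ∨ A * σ * B = -τ) →
      ∀ M : QMat, (∃ c ∈ ({1, -1, Complex.I, -Complex.I} : Set ℂ),
        ∃ σ ∈ ({1, pauliX, pauliY, pauliZ} : Set QMat), M = c • σ) →
      (∃ c ∈ ({1, -1, Complex.I, -Complex.I} : Set ℂ),
        ∃ σ ∈ ({1, pauliX, pauliY, pauliZ} : Set QMat), A * M * B = c • σ) := by
    rintro A B hAB hc M ⟨c, hcm, σ, hσ, rfl⟩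
    rcases hσ with rfl | hσ
    · exact ⟨c, hcm, 1, Or.inl rfl, by simp [hAB]⟩
    · obtain ⟨τ, hτ, e | e⟩ := hc σ hσ
      · exact ⟨c, hcm, τ, Or.inr hτ, by simp [e]⟩
      · exact ⟨-c, neg c hcm, τ, Or.inr hτ, by simp [e]⟩
  intro P
  constructor
  · intro hP
    exact key _ _ hU h P hP
  · intro hP
    have := key _ _ hU' h' _ hP
    have e : star (U : QMat) * ((U * P * U⁻¹ : Matrix.unitaryGroup (Fin 2) ℂ) : QMat) * (U : QMat)
        = P := by
      change star (U : QMat) * ((U : QMat) * (P : QMat) * star (U : QMat)) * (U : QMat) = P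
      calc _ = (star (U : QMat) * (U : QMat)) * (P : QMat) * (star (U : QMat) * (U : QMat)) := by
            simp only [mul_assoc]
        _ = P := by simp [hU']
    rw [e] at this
    exact this

theorem sqrt_two_inv_mul_self :
    ((Real.sqrt 2 : ℝ) : ℂ)⁻¹ * ((Real.sqrt 2 : ℝ) : ℂ)⁻¹ = 1 / 2 := by
  rw [← mul_inv, ← Complex.ofReal_mul, Real.mul_self_sqrt (by norm_num)]
  norm_num


/-- The phase gate `S` as a Clifford operator. -/
def phaseOp : cliffordOps :=
  ⟨⟨phaseMat, by
      rw [Matrix.mem_unitaryGroup_iff]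
      ext i j
      fin_cases i <;> fin_cases j <;> simp [phaseMat, Matrix.mul_apply]⟩, by
    apply mem_cliffordOps_of_conj
    · rintro σ (rfl | rfl | rfl)
      · refine ⟨pauliY, by simp, Or.inl ?_⟩
        ext i j
        fin_cases i <;> fin_cases j <;>
          simp [phaseMat, pauliX, pauliY, Matrix.mul_apply]
      · refine ⟨pauliX, by simp, Or.inr ?_⟩
        ext i j
        fin_cases i <;> fin_cases j <;>
          simp [phaseMat, pauliX, pauliY, Matrix.mul_apply]
      · refine ⟨pauliZ, by simp, Or.inl ?_⟩
        ext i j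
        fin_cases i <;> fin_cases j <;>
          simp [phaseMat, pauliZ, Matrix.mul_apply]
    · rintro σ (rfl | rfl | rfl)
      · refine ⟨pauliY, by simp, Or.inr ?_⟩
        ext i j
        fin_cases i <;> fin_cases j <;>
          simp [phaseMat, pauliX, pauliY, Matrix.mul_apply]
      · refine ⟨pauliX, by simp, Or.inl ?_⟩
        ext i j
        fin_cases i <;> fin_cases j <;>
          simp [phaseMat, pauliX, pauliY, Matrix.mul_apply]
      · refine ⟨pauliZ, by simp, Or.inl ?_⟩
        ext i j
        fin_cases i <;> fin_cases j <;>
          simp [phaseMat, pauliZ, Matrix.mul_apply]⟩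

/-- The Pauli matrix `Z` as a Clifford operator. -/
def zOp : cliffordOps :=
  ⟨⟨pauliZ, by
      rw [Matrix.mem_unitaryGroup_iff]
      ext i j
      fin_cases i <;> fin_cases j <;> simp [pauliZ, Matrix.mul_apply]⟩, by
    have e : (phaseMat * phaseMat : QMat) = pauliZ := by
      ext i j
      fin_cases i <;> fin_cases j <;> simp [phaseMat, pauliZ, Matrix.mul_apply]
    have h := (phaseOp * phaseOp).2
    convert h using 1
    exact Subtype.ext e.symm⟩

theorem sqrtIXMat_eq : sqrtIXMat =
    !![((Real.sqrt 2 : ℝ) : ℂ)⁻¹, ((Real.sqrt 2 : ℝ) : ℂ)⁻¹ * Complex.I;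
       ((Real.sqrt 2 : ℝ) : ℂ)⁻¹ * Complex.I, ((Real.sqrt 2 : ℝ) : ℂ)⁻¹] := by
  ext i j
  fin_cases i <;> fin_cases j <;> simp [sqrtIXMat, pauliX]

/-- `√(iX)` as a Clifford operator. -/
def sqrtIXOp : cliffordOps :=
  ⟨⟨sqrtIXMat, by
      rw [Matrix.mem_unitaryGroup_iff, sqrtIXMat_eq]
      have h := sqrt_two_inv_mul_self
      set s := ((Real.sqrt 2 : ℝ) : ℂ)⁻¹ with hs
      have hc : (starRingEnd ℂ) s = s := by simp [hs]
      have hI := Complex.I_mul_I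
      ext i j
      fin_cases i <;> fin_cases j <;> simp [Matrix.mul_apply, hc] <;> grind⟩, by
    have h := sqrt_two_inv_mul_self
    apply mem_cliffordOps_of_conj
    all_goals
      simp only [sqrtIXMat_eq]
      set s := ((Real.sqrt 2 : ℝ) : ℂ)⁻¹ with hs
      have hc : (starRingEnd ℂ) s = s := by simp [hs]
      have hI := Complex.I_mul_I
    · rintro σ (rfl | rfl | rfl)
      · refine ⟨pauliX, by simp, Or.inl ?_⟩
        ext i j
        fin_cases i <;> fin_cases j <;> simp [pauliX, Matrix.mul_apply, hc] <;> grind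
      · refine ⟨pauliZ, by simp, Or.inr ?_⟩
        ext i j
        fin_cases i <;> fin_cases j <;> simp [pauliY, pauliZ, Matrix.mul_apply, hc] <;> grind
      · refine ⟨pauliY, by simp, Or.inl ?_⟩
        ext i j
        fin_cases i <;> fin_cases j <;> simp [pauliY, pauliZ, Matrix.mul_apply, hc] <;> grind
    · rintro σ (rfl | rfl | rfl)
      · refine ⟨pauliX, by simp, Or.inl ?_⟩
        ext i j
        fin_cases i <;> fin_cases j <;> simp [pauliX, Matrix.mul_apply, hc] <;> grind
      · refine ⟨pauliZ, by simp, Or.inl ?_⟩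
        ext i j
        fin_cases i <;> fin_cases j <;> simp [pauliY, pauliZ, Matrix.mul_apply, hc] <;> grind
      · refine ⟨pauliY, by simp, Or.inr ?_⟩
        ext i j
        fin_cases i <;> fin_cases j <;> simp [pauliY, pauliZ, Matrix.mul_apply, hc] <;> grind⟩

theorem sqrtNegIZMat_eq : sqrtNegIZMat =
    !![((Real.sqrt 2 : ℝ) : ℂ)⁻¹ * (1 - Complex.I), 0;
       0, ((Real.sqrt 2 : ℝ) : ℂ)⁻¹ * (1 + Complex.I)] := by
  ext i j
  fin_cases i <;> fin_cases j <;> simp [sqrtNegIZMat, pauliZ]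

/-- `√(-iZ)` as a Clifford operator. -/
def sqrtNegIZOp : cliffordOps :=
  ⟨⟨sqrtNegIZMat, by
      rw [Matrix.mem_unitaryGroup_iff, sqrtNegIZMat_eq]
      have h := sqrt_two_inv_mul_self
      set s := ((Real.sqrt 2 : ℝ) : ℂ)⁻¹ with hs
      have hc : (starRingEnd ℂ) s = s := by simp [hs]
      have hI := Complex.I_mul_I
      ext i j
      fin_cases i <;> fin_cases j <;> simp [Matrix.mul_apply, hc] <;> grind⟩, by
    have h := sqrt_two_inv_mul_self
    apply mem_cliffordOps_of_conj
    all_goals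
      simp only [sqrtNegIZMat_eq]
      set s := ((Real.sqrt 2 : ℝ) : ℂ)⁻¹ with hs
      have hc : (starRingEnd ℂ) s = s := by simp [hs]
      have hI := Complex.I_mul_I
    · rintro σ (rfl | rfl | rfl)
      · refine ⟨pauliY, by simp, Or.inl ?_⟩
        ext i j
        fin_cases i <;> fin_cases j <;> simp [pauliX, pauliY, Matrix.mul_apply, hc] <;> grind
      · refine ⟨pauliX, by simp, Or.inr ?_⟩
        ext i j
        fin_cases i <;> fin_cases j <;> simp [pauliX, pauliY, Matrix.mul_apply, hc] <;> grind
      · refine ⟨pauliZ, by simp, Or.inl ?_⟩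
        ext i j
        fin_cases i <;> fin_cases j <;> simp [pauliZ, Matrix.mul_apply, hc] <;> grind
    · rintro σ (rfl | rfl | rfl)
      · refine ⟨pauliY, by simp, Or.inr ?_⟩
        ext i j
        fin_cases i <;> fin_cases j <;> simp [pauliX, pauliY, Matrix.mul_apply, hc] <;> grind
      · refine ⟨pauliX, by simp, Or.inl ?_⟩
        ext i j
        fin_cases i <;> fin_cases j <;> simp [pauliX, pauliY, Matrix.mul_apply, hc] <;> grind
      · refine ⟨pauliZ, by simp, Or.inl ?_⟩
        ext i j
        fin_cases i <;> fin_cases j <;> simp [pauliZ, Matrix.mul_apply, hc] <;> grind⟩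

/-- `√(iX)` modulo global phase. -/
def sqrtIX : LocalClifford := cliffordClass sqrtIXOp

/-- `√(-iZ)` modulo global phase. -/
def sqrtNegIZ : LocalClifford := cliffordClass sqrtNegIZOp

/-- `√(-iX) = √(iX)†` modulo global phase. -/
def sqrtNegIX : LocalClifford := sqrtIX⁻¹

/-- `√(iZ) = √(-iZ)†` modulo global phase. -/
def sqrtIZ : LocalClifford := sqrtNegIZ⁻¹

/-- The set `𝒵 = {I, Z, S, S†}` of local Clifford operators (modulo global phase). -/
def zSet : Set LocalClifford :=
  {1, cliffordClass zOp, cliffordClass phaseOp, cliffordClass phaseOp⁻¹}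

/-! ### Multi-qubit operators, graph states -/

/-- Vectors of the qubit register `(ℂ²)^{⊗V}`, by their amplitudes in the computational basis. -/
abbrev QState (V : Type*) := (V → Fin 2) → ℂ

/-- Operators on the qubit register. -/
abbrev QOp (V : Type*) := Matrix (V → Fin 2) (V → Fin 2) ℂ

/-- The tensor product `⨂_v A_v` of single-qubit operators. -/
def tensorOp {V : Type*} [Fintype V] (A : V → QMat) : QOp V :=
  Matrix.of fun x y => ∏ v, A v (x v) (y v)

/-- The diagonal of the controlled phase gate on the pair of qubits `e`: the sign is `-1` exactly
on the basis states in which both qubits of `e` are `1`. -/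
def czSign {V : Type*} (e : Sym2 V) (x : V → Fin 2) : ℂ :=
  open Classical in if ∀ v ∈ e, x v = 1 then -1 else 1

/-- The controlled phase gate `ΛZ_{ab}`. -/
def controlledZ {V : Type*} [Fintype V] [DecidableEq V] (a b : V) : QOp V := Matrix.diagonal (czSign s(a, b))

/-- The graph state `|G⟩ = (∏_{{a,b} ∈ E} ΛZ_{ab}) (∏_a H_a) |0…0⟩`.
The phase gates are diagonal, so their product is taken entrywise on the diagonals. -/
def graphState {V : Type*} [Fintype V] [DecidableEq V] (G : SimpleGraph V) : QState V :=
  open Classical in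
  Matrix.mulVec (Matrix.diagonal (∏ e ∈ G.edgeFinset, czSign e))
    (Matrix.mulVec (tensorOp fun _ => hadamardMat) (Pi.single (fun _ => 0) 1))

/-- The correlation operator `K_G^{(a)} = X_a ∏_{b ∈ ngbh a} Z_b`. -/
def correlationOp {V : Type*} [Fintype V] [DecidableEq V] (G : SimpleGraph V) (a : V) : QOp V :=
  open Classical in
  tensorOp fun v => if v = a then pauliX else if G.Adj a v then pauliZ else 1

/-- `φ = z ψ` for a complex number `z` of modulus `1`. -/
def EqUpToPhase {V : Type*} (φ ψ : QState V) : Prop := ∃ z : ℂ, ‖z‖ = 1 ∧ φ = z • ψ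

theorem tensorOp_mulVec_monomial {V : Type*} [Fintype V] [DecidableEq V]
    (A : V → QMat) (p : V → Fin 2 → Fin 2) (d : V → Fin 2 → ℂ)
    (h : ∀ v i j, A v i j = if j = p v i then d v i else 0) (ψ : QState V) (x : V → Fin 2) :
    Matrix.mulVec (tensorOp A) ψ x = (∏ v, d v (x v)) * ψ (fun v => p v (x v)) := by
  change ∑ y, (∏ v, A v (x v) (y v)) * ψ y = _
  rw [Finset.sum_eq_single (fun v => p v (x v))]
  · simp [h]
  · intro y _ hy
    obtain ⟨v, hv⟩ : ∃ v, y v ≠ p v (x v) := by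
      by_contra! hc
      exact hy (funext hc)
    rw [Finset.prod_eq_zero (Finset.mem_univ v), zero_mul]
    simp [h, hv]
  · simp

theorem graphState_apply {V : Type*} [Fintype V] [DecidableEq V]
    (G : SimpleGraph V) (x : V → Fin 2) :
    graphState G x = (open Classical in ∏ e ∈ G.edgeFinset, czSign e x)
      * (((Real.sqrt 2 : ℝ) : ℂ)⁻¹) ^ Fintype.card V := by
  classical
  have h : Matrix.mulVec (tensorOp fun _ : V => hadamardMat) (Pi.single (fun _ => 0) 1) x
      = (((Real.sqrt 2 : ℝ) : ℂ)⁻¹) ^ Fintype.card V := by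
    rw [Matrix.mulVec_single_one]
    have : ∀ i : Fin 2, hadamardMat i 0 = ((Real.sqrt 2 : ℝ) : ℂ)⁻¹ := by
      intro i
      fin_cases i <;> simp [hadamardMat]
    simp [tensorOp, this]
  rw [graphState, Matrix.mulVec_diagonal, h, Finset.prod_apply]

theorem correlationOp_mulVec {V : Type*} [Fintype V] [DecidableEq V]
    (G : SimpleGraph V) (a : V) (ψ : QState V) (x : V → Fin 2) :
    Matrix.mulVec (correlationOp G a) ψ x
      = (open Classical in ∏ v, if G.Adj a v ∧ x v = 1 then (-1 : ℂ) else 1)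
        * ψ (Function.update x a (x a + 1)) := by
  classical
  rw [correlationOp, tensorOp_mulVec_monomial _ (fun v i => if v = a then i + 1 else i)
    (fun v i => if G.Adj a v ∧ i = 1 then (-1 : ℂ) else 1)]
  · congr 2
    ext v
    by_cases hv : v = a
    · subst hv; simp
    · simp [hv]
  · intro v i j
    by_cases hv : v = a
    · subst hv
      fin_cases i <;> fin_cases j <;> simp [pauliX]
    · by_cases hg : G.Adj a v
      · fin_cases i <;> fin_cases j <;> simp [hv, hg, pauliZ]
      · fin_cases i <;> fin_cases j <;> simp [hv, hg]

theorem prod_czSign_update {V : Type*} [Fintype V] [DecidableEq V]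
    (G : SimpleGraph V) (a : V) (x : V → Fin 2) :
    (open Classical in ∏ e ∈ G.edgeFinset, czSign e x)
      = (open Classical in ∏ v, if G.Adj a v ∧ x v = 1 then (-1 : ℂ) else 1)
        * (open Classical in ∏ e ∈ G.edgeFinset, czSign e (Function.update x a (x a + 1))) := by
  classical
  have h1 : (∏ v, if G.Adj a v ∧ x v = 1 then (-1 : ℂ) else 1)
      = ∏ e ∈ G.edgeFinset,
        if a ∈ e ∧ ∀ v ∈ e, v ≠ a → x v = 1 then (-1 : ℂ) else 1 := by
    rw [← Finset.prod_filter_mul_prod_filter_not G.edgeFinset (fun e => a ∈ e)]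
    rw [Finset.prod_congr rfl (g := fun _ => (1 : ℂ))
      (s₁ := G.edgeFinset.filter fun e => ¬ a ∈ e), Finset.prod_const_one, mul_one]
    swap
    · intro e he
      simp [(Finset.mem_filter.1 he).2]
    rw [← Finset.prod_filter_mul_prod_filter_not Finset.univ (fun v => G.Adj a v)]
    rw [Finset.prod_congr rfl (g := fun _ => (1 : ℂ))
      (s₁ := Finset.univ.filter fun v => ¬ G.Adj a v), Finset.prod_const_one, mul_one]
    swap
    · intro e he
      simp [(Finset.mem_filter.1 he).2]
    refine Finset.prod_bij (fun v _ => s(a, v)) ?_ ?_ ?_ ?_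
    · intro v hv
      simpa using hv
    · intro v _ w _ hvw
      exact Sym2.congr_right.1 hvw
    · intro e he
      rw [Finset.mem_filter] at he
      obtain ⟨w, rfl⟩ := he.2
      exact ⟨w, by simpa using he.1, rfl⟩
    · intro v hv
      have hg : G.Adj a v := by simpa using hv
      have : v ≠ a := hg.ne'
      simp [hg, this]
  rw [h1, ← Finset.prod_mul_distrib]
  refine Finset.prod_congr rfl fun e he => ?_
  induction e with
  | _ p q =>
    have hpq : p ≠ q := by
      have : G.Adj p q := by simpa using he
      exact this.ne
    have hx : x a = 0 ∨ x a = 1 := by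
      generalize x a = i
      fin_cases i <;> simp
    by_cases hp : p = a
    · subst hp
      rcases hx with hx | hx <;> by_cases hq : x q = 1 <;>
        simp [czSign, hx, hq, hpq.symm]
    · by_cases hq : q = a
      · subst hq
        rcases hx with hx | hx <;> by_cases hq : x p = 1 <;>
          simp [czSign, hx, hq, hpq]
      · simp [czSign, hp, hq, Ne.symm hp, Ne.symm hq]

/-- The graph state is, up to a scalar factor, the unique solution of the eigenvalue equations
`K_G^{(a)} ψ = ψ`, `a ∈ V`. -/
theorem correlationOp_fixed_iff {V : Type*} [Fintype V] [DecidableEq V]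
    (G : SimpleGraph V) (ψ : QState V) :
    (∀ a, Matrix.mulVec (correlationOp G a) ψ = ψ) ↔ ∃ z : ℂ, ψ = z • graphState G := by
  classical
  have hg0 : ∀ x, graphState G x ≠ 0 := by
    intro x
    rw [graphState_apply]
    refine mul_ne_zero (Finset.prod_ne_zero_iff.2 fun e _ => ?_) (by simp)
    unfold czSign
    split_ifs <;> simp
  have hg : ∀ a x, graphState G x
      = (∏ v, if G.Adj a v ∧ x v = 1 then (-1 : ℂ) else 1)
        * graphState G (Function.update x a (x a + 1)) := by
    intro a x
    rw [graphState_apply, graphState_apply, ← mul_assoc, ← prod_czSign_update]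
  constructor
  · intro h
    have hψ : ∀ a x, ψ x = (∏ v, if G.Adj a v ∧ x v = 1 then (-1 : ℂ) else 1)
        * ψ (Function.update x a (x a + 1)) := by
      intro a x
      rw [← correlationOp_mulVec, h a]
    have hr : ∀ a x, ψ x / graphState G x
        = ψ (Function.update x a (x a + 1)) / graphState G (Function.update x a (x a + 1)) := by
      intro a x
      rw [hψ a x, hg a x, mul_div_mul_left]
      refine Finset.prod_ne_zero_iff.2 fun v _ => ?_
      split_ifs <;> simp
    have hc : ∀ (s : Finset V) (x : V → Fin 2), (∀ v ∉ s, x v = 0) →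
        ψ x / graphState G x = ψ (fun _ => 0) / graphState G (fun _ => 0) := by
      intro s
      induction s using Finset.induction_on with
      | empty =>
        intro x hx
        rw [show x = fun _ => 0 from funext fun v => hx v (by simp)]
      | insert a s ha ih =>
        intro x hx
        have hxa : x a = 0 ∨ x a = 1 := by
          generalize x a = i
          fin_cases i <;> simp
        rcases hxa with hxa | hxa
        · refine ih x fun v hv => ?_
          by_cases hva : v = a
          · rw [hva, hxa]
          · exact hx v (by simp [hva, hv])
        · rw [hr a x]
          refine ih _ fun v hv => ?_
          by_cases hva : v = a
          · subst hva
            simp [hxa]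
          · simpa [hva] using hx v (by simp [hva, hv])
    refine ⟨ψ (fun _ => 0) / graphState G (fun _ => 0), funext fun x => ?_⟩
    rw [Pi.smul_apply, smul_eq_mul, ← hc Finset.univ x (by simp), div_mul_cancel₀ _ (hg0 x)]
  · rintro ⟨z, rfl⟩ a
    rw [Matrix.mulVec_smul]
    congr 1
    funext x
    rw [correlationOp_mulVec, ← hg]

/-- The state `|G; C⟩ = (⨂_v C_v) |G⟩`. -/
def vopState {V : Type*} [Fintype V] [DecidableEq V] (G : SimpleGraph V) (C : V → cliffordOps) :
    QState V :=
  Matrix.mulVec (tensorOp fun v => cliffordMat (C v)) (graphState G)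

/-! ### The simulator register -/

/-- The data stored by the simulator: a graph and the vertex operators (VOPs), the latter modulo
global phases. -/
structure GraphRegister (V : Type*) where
  graph : SimpleGraph V
  vop : V → LocalClifford

/-- The register `r` represents the vector `ψ`: up to a global phase, `ψ = |G; C⟩` for the graph
`G` of `r` and all choices `C` of representatives of its vertex operators. -/
def GraphRegister.Represents {V : Type*} [Fintype V] [DecidableEq V] (r : GraphRegister V)
    (ψ : QState V) : Prop :=
  ∀ C : V → cliffordOps, (∀ v, cliffordClass (C v) = r.vop v) →
    EqUpToPhase ψ (vopState r.graph C)

/-- The choice of the representatives only affects the global phase. -/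
theorem represents_vopState {V : Type*} [Fintype V] [DecidableEq V] (G : SimpleGraph V)
    (C : V → cliffordOps) :
    (⟨G, fun v => cliffordClass (C v)⟩ : GraphRegister V).Represents (vopState G C) := by
  intro C' hC'
  have h : ∀ v, ∃ z : ℂ, ‖z‖ = 1 ∧ cliffordMat (C v) = z • cliffordMat (C' v) := by
    intro v
    obtain ⟨z, hz⟩ : (C' v)⁻¹ * C v ∈ globalPhases := QuotientGroup.eq.1 (hC' v)
    refine ⟨z, ?_, ?_⟩
    · have h1 := Matrix.mem_unitaryGroup_iff.1 ((C' v)⁻¹ * C v).1.2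
      rw [hz] at h1
      have h2 := congrFun (congrFun h1 0) 0
      simp only [star_smul, star_one, Matrix.mul_smul, Matrix.smul_apply,
        Matrix.one_apply_eq, smul_eq_mul, mul_one] at h2
      have h3 : (‖z‖ : ℝ) ^ 2 = 1 := by
        have h4 : z * (starRingEnd ℂ) z = 1 := (mul_comm _ _).trans h2
        rw [Complex.mul_conj, Complex.normSq_eq_norm_sq] at h4
        exact_mod_cast h4
      exact (pow_eq_one_iff_of_nonneg (norm_nonneg z) two_ne_zero).1 h3
    · have h1 : C v = C' v * ((C' v)⁻¹ * C v) := by group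
      have h2 : cliffordMat (C v) = cliffordMat (C' v)
          * ((((C' v)⁻¹ * C v : cliffordOps) : Matrix.unitaryGroup (Fin 2) ℂ) : QMat) :=
        congrArg cliffordMat h1
      rw [h2, hz]
      simp
  choose z hz1 hz2 using h
  refine ⟨∏ v, z v, by simp [hz1], ?_⟩
  unfold vopState
  rw [← Matrix.smul_mulVec]
  congr 1
  ext x y
  simp [tensorOp, hz2, Finset.prod_mul_distrib]

/-- Local complementation `L_a` of a graph:
the edge set becomes `E ∆ {{b, c} | b, c ∈ ngbh a}` (loops being discarded). -/
def localComplement {V : Type*} (G : SimpleGraph V) (a : V) : SimpleGraph V :=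
  G ∆ SimpleGraph.fromEdgeSet
    {e | ∃ b ∈ G.neighborSet a, ∃ c ∈ G.neighborSet a, e = s(b, c)}

namespace GraphRegister

variable {V : Type*}

/-- Local complementation about `v` with the compensating update of the vertex operators. -/
def localComplementation (r : GraphRegister V) (v : V) : GraphRegister V where
  graph := localComplement r.graph v
  vop := open Classical in fun w =>
    if w = v then r.vop w * sqrtIX
    else if r.graph.Adj v w then r.vop w * sqrtNegIZ
    else r.vop w

/-- Toggling the edge `{a, b}`. -/
def toggleEdge (r : GraphRegister V) (a b : V) : GraphRegister V where
  graph := r.graph ∆ SimpleGraph.edge a b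
  vop := r.vop

/-- The neighbours of `a` other than `b`. -/
def otherNeighbors (r : GraphRegister V) (a b : V) : Set V := r.graph.neighborSet a \ {b}

end GraphRegister

/-! ### The two lookup tables -/

/-- The two factors used in decompositions of local Clifford operators. -/
inductive CliffordFactor where
  | negIX
  | posIZ

/-- `negIX` stands for `√(-iX)` and `posIZ` for `√(iZ)`. -/
def CliffordFactor.val : CliffordFactor → LocalClifford
  | negIX => sqrtNegIX
  | posIZ => sqrtIZ

/-- `D` spells out every local Clifford operator as a product of at most 5 factors `√(-iX)` and
`√(iZ)`, up to a global phase. -/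
def IsDecompositionTable (D : LocalClifford → List CliffordFactor) : Prop :=
  ∀ C, (D C).length ≤ 5 ∧ ((D C).map CliffordFactor.val).prod = C

/-- The register on two qubits with given VOPs, with an edge iff `e` is true. -/
def twoQubitRegister (e : Bool) (C₁ C₂ : LocalClifford) : GraphRegister (Fin 2) where
  graph := if e then ⊤ else ⊥
  vop := ![C₁, C₂]

/-- Candidates for the lookup table of the phase gate on two qubits: a line maps the edge bit and
the two VOPs to the new edge bit and the two new VOPs. -/
abbrev PhaseTable := Bool → LocalClifford → LocalClifford → Bool × LocalClifford × LocalClifford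

/-- Every line of the table is correct: it describes the action of `ΛZ` on the two-qubit state. -/
def PhaseTable.IsCorrect (T : PhaseTable) : Prop :=
  ∀ (e : Bool) (C₁ C₂ : LocalClifford) (ψ : QState (Fin 2)),
    (twoQubitRegister e C₁ C₂).Represents ψ →
      (twoQubitRegister (T e C₁ C₂).1 (T e C₁ C₂).2.1 (T e C₁ C₂).2.2).Represents
        (Matrix.mulVec (controlledZ 0 1) ψ)

/-- A VOP in `𝒵` is sent to a VOP in `𝒵`, for each of the two vertices. -/
def PhaseTable.PreservesZ (T : PhaseTable) : Prop :=
  ∀ (e : Bool) (C₁ C₂ : LocalClifford),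
    (C₁ ∈ zSet → (T e C₁ C₂).2.1 ∈ zSet) ∧ (C₂ ∈ zSet → (T e C₁ C₂).2.2 ∈ zSet)

/-! ### The procedures -/

namespace GraphRegister

variable {V : Type*}

/-- The successive centres of the local complementations that reduce the VOP of `a` with swapping
partner `c`: the decomposition of the VOP is read from right to left, `√(-iX)` giving the
centre `a` and `√(iZ)` the centre `c`. -/
def reductionCenters (D : LocalClifford → List CliffordFactor) (r : GraphRegister V) (a c : V) :
    List V :=
  (D (r.vop a)).reverse.map fun f =>
    match f with
    | CliffordFactor.negIX => a
    | CliffordFactor.posIZ => c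

/-- The reduction of the VOP of `a` with swapping partner `c`. -/
def reduceVOP (D : LocalClifford → List CliffordFactor) (r : GraphRegister V) (a c : V) :
    GraphRegister V :=
  (r.reductionCenters D a c).foldl localComplementation r

/-- `remove_VOP(a, b)` may turn `r` into `r'`: the swapping partner `c` is any neighbour of `a`
other than `b` if there is one, and `b` otherwise. -/
def RemoveVOP (D : LocalClifford → List CliffordFactor) (a b : V) (r r' : GraphRegister V) :
    Prop :=
  ∃ c, ((r.otherNeighbors a b).Nonempty ∧ c ∈ r.otherNeighbors a b ∨
      r.otherNeighbors a b = ∅ ∧ c = b) ∧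
    r' = r.reduceVOP D a c

/-- `if ngbh a \ {b} ≠ {} then remove_VOP(a, b)` may turn `r` into `r'`. -/
def TryRemoveVOP (D : LocalClifford → List CliffordFactor) (a b : V) (r r' : GraphRegister V) :
    Prop :=
  (r.otherNeighbors a b).Nonempty ∧ RemoveVOP D a b r r' ∨
    r.otherNeighbors a b = ∅ ∧ r' = r

/-- The first part of `cphase(a, b)`, before the table lookup, may turn `r` into `r'`. -/
def PrepareCPhase (D : LocalClifford → List CliffordFactor) (a b : V) (r r' : GraphRegister V) :
    Prop :=
  ∃ r₁ r₂, TryRemoveVOP D a b r r₁ ∧ TryRemoveVOP D b a r₁ r₂ ∧ TryRemoveVOP D a b r₂ r'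

/-- Each operand vertex has no non-operand neighbour or has its VOP in `𝒵`. -/
def ReadyForLookup (r : GraphRegister V) (a b : V) : Prop :=
  (r.otherNeighbors a b = ∅ ∨ r.vop a ∈ zSet) ∧ (r.otherNeighbors b a = ∅ ∨ r.vop b ∈ zSet)

/-- The table lookup: replace the edge bit of `{a, b}` and the VOPs of `a` and `b` as told by `T`,
leaving everything else unchanged. -/
def lookupCPhase (T : PhaseTable) (a b : V) (r : GraphRegister V) : GraphRegister V :=
  open Classical in
  let line := T (decide (r.graph.Adj a b)) (r.vop a) (r.vop b)
  { graph := (r.graph \ SimpleGraph.edge a b) ⊔ (if line.1 then SimpleGraph.edge a b else ⊥)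
    vop := Function.update (Function.update r.vop a line.2.1) b line.2.2 }

/-- `cphase(a, b)` may turn `r` into `r'` (the choices are those of the swapping partners). -/
def CPhase (D : LocalClifford → List CliffordFactor) (T : PhaseTable) (a b : V)
    (r r' : GraphRegister V) : Prop :=
  ∃ r₁, PrepareCPhase D a b r r₁ ∧ r' = lookupCPhase T a b r₁

end GraphRegister

end

/-! Modulo phase, a Clifford operator is determined by the signed Pauli matrices into which it
conjugates X and Z, and these two are of different kinds. Questions about words in `√(-iX)`, `√(iZ)`
thus become finite checks (`exists_word_of_conj`), among them the existence of decompositions of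
length at most 5.

The amplitudes of a graph state are, up to normalization, signs that multiply under symmetric
difference of edge sets (`graphSign_symmDiff`). Hence toggling an edge is a phase gate, and it
passes through diagonal VOPs. Local complementation about `a` fixes the state up to phase: only two
amplitudes interfere, and their sum is governed by the number of neighbours with bit 1
(`vopState_localComplement`). Complementing about `a` or about a neighbour `c` cancels the last
letter of the word of `C_a` and keeps the edge `{a, c}`, so reduction strips the word
(`foldl_localComplementation_vop`).

If each operand has a diagonal VOP or no non-operand neighbour, the amplitudes are a two-qubit
amplitude times a factor that does not involve the edge `{a, b}` or the operand VOPs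
(`vopState_sup_edge`). A table line then acts on the first factor alone; Constraint 1 makes the same
factorization valid after the lookup.

The table exists because the VOPs can be brought to one of two forms: both diagonal, where toggling
works, or one with `C X C† = ±Z`. There a stabilizer equation turns one `Z` into `±1` or `±Z` of the
other qubit, so the phase gate acts as `I` or `Z`.

The delicate case of `cphase` is a second reduction of `a` when step (2) was skipped. The word of
`I` may be nonempty, but then it is a fourth power of one letter, and local complementation is an
involution on graphs, so `b` gains no neighbours. -/

/-! ### The local Clifford group -/

noncomputable section

/-- The Pauli matrices `X, Y, Z` (indexed by `0, 1, 2`) with a sign, `true` meaning `-`. -/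
def signedPauli (s : Fin 3 × Bool) : QMat :=
  (if s.2 then (-1 : ℂ) else 1) • ![pauliX, pauliY, pauliZ] s.1

end

/-! ### Words acting on signed Pauli matrices: finite checks -/

/-- The image of a signed Pauli matrix under conjugation with one of the two Clifford factors. -/
def CliffordFactor.conj : CliffordFactor → Fin 3 × Bool → Fin 3 × Bool
  | .negIX, (0, s) => (0, s)
  | .negIX, (1, s) => (2, s)
  | .negIX, (2, s) => (1, !s)
  | .posIZ, (0, s) => (1, !s)
  | .posIZ, (1, s) => (0, s)
  | .posIZ, (2, s) => (2, s)

/-- The image of a signed Pauli matrix under conjugation with a word in the Clifford factors. -/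
def conjWord (w : List CliffordFactor) (s : Fin 3 × Bool) : Fin 3 × Bool :=
  w.foldr CliffordFactor.conj s

/-- The words of length `n` in the Clifford factors. -/
def wordsOfLength : ℕ → List (List CliffordFactor)
  | 0 => [[]]
  | n + 1 => (wordsOfLength n).flatMap fun w => [.negIX :: w, .posIZ :: w]

/-- The words of length at most five in the Clifford factors. -/
def shortWords : List (List CliffordFactor) :=
  (List.range 6).flatMap wordsOfLength

theorem mem_wordsOfLength (w : List CliffordFactor) : w ∈ wordsOfLength w.length := by
  induction w with
  | nil => simp [wordsOfLength]
  | cons f w ih =>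
    refine List.mem_flatMap.2 ⟨w, ih, ?_⟩
    cases f <;> simp

theorem length_of_mem_wordsOfLength {n : ℕ} {w : List CliffordFactor}
    (h : w ∈ wordsOfLength n) : w.length = n := by
  induction n generalizing w with
  | zero => simpa [wordsOfLength] using h
  | succ n ih =>
    obtain ⟨u, hu, hw⟩ := List.mem_flatMap.1 h
    have := ih hu
    rcases List.mem_pair.1 hw with rfl | rfl <;> simp [this]

theorem mem_shortWords {w : List CliffordFactor} : w ∈ shortWords ↔ w.length ≤ 5 := by
  constructor
  · intro h
    obtain ⟨n, hn, hw⟩ := List.mem_flatMap.1 h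
    have := length_of_mem_wordsOfLength hw
    have := List.mem_range.1 hn
    omega
  · intro h
    exact List.mem_flatMap.2 ⟨w.length, List.mem_range.2 (by omega), mem_wordsOfLength w⟩

set_option maxRecDepth 100000 in
-- The 24 admissible pairs of images of X and Z are compared with the 63 words of length at most 5.
theorem exists_shortWord_conj : ∀ p q : Fin 3 × Bool, p.1 ≠ q.1 →
    ∃ w ∈ shortWords, conjWord w (0, false) = p ∧ conjWord w (2, false) = q := by
  decide

set_option maxRecDepth 100000 in
-- Rotations about X act first: they fix X and turn Z through `±Y`, `±Z`. Rotations about Z then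
-- carry X to any of `±X`, `±Y`. So these products reach exactly the operators that do not send X to
-- `±Z`.
theorem exists_conj_posIZ_negIX : ∀ p q : Fin 3 × Bool, p.1 ≠ q.1 → p.1 ≠ 2 →
    ∃ j < 4, ∃ k < 4,
      conjWord (List.replicate j .posIZ ++ List.replicate k .negIX) (0, false) = p ∧
      conjWord (List.replicate j .posIZ ++ List.replicate k .negIX) (2, false) = q := by
  decide

/-- Whether a Clifford factor is `√(-iX)`. -/
def CliffordFactor.isNegIX : CliffordFactor → Bool
  | .negIX => true
  | .posIZ => false

set_option maxRecDepth 100000 in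
-- Each letter is a quarter turn, hence of order 4 modulo phase; the check shows that there are no
-- other short relations. Passing to `Bool` provides the decidable equality of words.
theorem shortWord_trivial_conj : ∀ w ∈ shortWords,
    conjWord w (0, false) = (0, false) → conjWord w (2, false) = (2, false) →
    w.map CliffordFactor.isNegIX ∈ [[], List.replicate 4 true, List.replicate 4 false] := by
  decide

/-! ### Clifford operators modulo phase and their action on Pauli matrices -/

noncomputable section

theorem signedPauli_injective : Function.Injective signedPauli := by
  rintro ⟨i, s⟩ ⟨j, t⟩ h
  have h00 := congrFun (congrFun h 0) 0
  have h01 := congrFun (congrFun h 0) 1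
  have h10 := congrFun (congrFun h 1) 0
  have n1 : (-1 : ℂ) ≠ 1 := by norm_num
  have n2 : (1 : ℂ) ≠ -1 := by norm_num
  have n3 : (Complex.I : ℂ) ≠ 1 := fun h => by simpa using congrArg Complex.re h
  have n4 : (Complex.I : ℂ) ≠ -1 := fun h => by simpa using congrArg Complex.re h
  have n5 : -(Complex.I : ℂ) ≠ 1 := fun h => by simpa using congrArg Complex.re h
  have n6 : (Complex.I : ℂ) ≠ -Complex.I := fun h => by
    have := congrArg Complex.im h
    norm_num at this
  fin_cases i <;> fin_cases j <;> cases s <;> cases t <;>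
    simp_all [signedPauli, pauliX, pauliY, pauliZ, n3.symm, n4.symm, n5.symm, n6.symm]

theorem cliffordMat_mul (U W : cliffordOps) :
    cliffordMat (U * W) = cliffordMat U * cliffordMat W := rfl

theorem cliffordMat_one : cliffordMat 1 = 1 := rfl

theorem cliffordMat_mul_inv (U : cliffordOps) : cliffordMat U * cliffordMat U⁻¹ = 1 := by
  rw [← cliffordMat_mul, mul_inv_cancel, cliffordMat_one]

theorem cliffordMat_inv_mul (U : cliffordOps) : cliffordMat U⁻¹ * cliffordMat U = 1 := by
  rw [← cliffordMat_mul, inv_mul_cancel, cliffordMat_one]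

theorem cliffordClass_mul (U W : cliffordOps) :
    cliffordClass (U * W) = cliffordClass U * cliffordClass W := rfl

theorem cliffordClass_surjective : Function.Surjective cliffordClass :=
  QuotientGroup.mk_surjective

/-- A Clifford factor as a Clifford operator. -/
def CliffordFactor.op : CliffordFactor → cliffordOps
  | .negIX => sqrtIXOp⁻¹
  | .posIZ => sqrtNegIZOp⁻¹

theorem CliffordFactor.class_op (f : CliffordFactor) : cliffordClass f.op = f.val := by
  cases f <;> rfl

theorem class_prod_op (w : List CliffordFactor) :
    cliffordClass (w.map CliffordFactor.op).prod = (w.map CliffordFactor.val).prod := by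
  induction w with
  | nil => rfl
  | cons f w ih => simp [cliffordClass_mul, ih, f.class_op]

/-- Conjugation is written as an intertwining relation throughout. The letters are inverses of
explicit matrices, so their relations are checked on those matrices and inverted here. -/
theorem cliffordMat_inv_mul_of_mul {U : cliffordOps} {P Q : QMat}
    (h : cliffordMat U * P = Q * cliffordMat U) :
    cliffordMat U⁻¹ * Q = P * cliffordMat U⁻¹ := by
  calc cliffordMat U⁻¹ * Q
      = cliffordMat U⁻¹ * (Q * cliffordMat U) * cliffordMat U⁻¹ := by
        rw [mul_assoc, mul_assoc, cliffordMat_mul_inv, mul_one]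
    _ = (cliffordMat U⁻¹ * cliffordMat U) * P * cliffordMat U⁻¹ := by
        rw [← h]; simp only [mul_assoc]
    _ = P * cliffordMat U⁻¹ := by rw [cliffordMat_inv_mul, one_mul]

theorem cliffordMat_factor_mul (f : CliffordFactor) (s : Fin 3 × Bool) :
    cliffordMat f.op * signedPauli s = signedPauli (f.conj s) * cliffordMat f.op := by
  obtain ⟨i, t⟩ := s
  have hI := Complex.I_mul_I
  cases f
  · refine cliffordMat_inv_mul_of_mul ?_
    change sqrtIXMat * _ = _ * sqrtIXMat
    rw [sqrtIXMat_eq]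
    ext k l
    fin_cases i <;> cases t <;> fin_cases k <;> fin_cases l <;>
      simp [signedPauli, CliffordFactor.conj, pauliX, pauliY, pauliZ, Matrix.mul_apply] <;> grind
  · refine cliffordMat_inv_mul_of_mul ?_
    change sqrtNegIZMat * _ = _ * sqrtNegIZMat
    rw [sqrtNegIZMat_eq]
    ext k l
    fin_cases i <;> cases t <;> fin_cases k <;> fin_cases l <;>
      simp [signedPauli, CliffordFactor.conj, pauliX, pauliY, pauliZ, Matrix.mul_apply] <;> grind

theorem cliffordMat_word_mul (w : List CliffordFactor) (s : Fin 3 × Bool) :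
    cliffordMat (w.map CliffordFactor.op).prod * signedPauli s
      = signedPauli (conjWord w s) * cliffordMat (w.map CliffordFactor.op).prod := by
  induction w with
  | nil => simp [conjWord, cliffordMat_one]
  | cons f w ih =>
    rw [List.map_cons, List.prod_cons, cliffordMat_mul, mul_assoc, ih, ← mul_assoc,
      cliffordMat_factor_mul, mul_assoc]
    rfl

theorem signedPauli_mul_self (s : Fin 3 × Bool) : signedPauli s * signedPauli s = 1 := by
  obtain ⟨i, t⟩ := s
  ext k l
  fin_cases i <;> cases t <;> fin_cases k <;> fin_cases l <;>
    simp [signedPauli, pauliX, pauliY, pauliZ, Matrix.mul_apply]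

/-- Being nonscalar excludes multiples of the identity, and `(cσ)² = c²` leaves only `c = ±1`. Both
conditions survive conjugation, so they confine conjugates of signed Pauli matrices to signed Pauli
matrices. -/
theorem exists_signedPauli_of_mem {P : Matrix.unitaryGroup (Fin 2) ℂ} (hP : P ∈ pauliGroup)
    (h1 : (P : QMat) * P = 1) (h2 : ∀ z : ℂ, (P : QMat) ≠ z • 1) :
    ∃ s, (P : QMat) = signedPauli s := by
  obtain ⟨c, hc, σ, hσ, e⟩ := hP
  have hσ' : ∃ i, σ = ![pauliX, pauliY, pauliZ] i := by
    rcases hσ with rfl | rfl | rfl | rfl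
    · exact absurd e (h2 c)
    · exact ⟨0, rfl⟩
    · exact ⟨1, rfl⟩
    · exact ⟨2, rfl⟩
  obtain ⟨i, rfl⟩ := hσ'
  have hs := signedPauli_mul_self (i, false)
  simp only [signedPauli, Bool.false_eq_true, if_false, one_smul] at hs
  rw [e, Matrix.smul_mul, Matrix.mul_smul, smul_smul, hs] at h1
  have h3 : c * c = 1 := by simpa using congrFun (congrFun h1 0) 0
  rcases mul_self_eq_one_iff.1 h3 with rfl | rfl
  · exact ⟨(i, false), by simp [e, signedPauli]⟩
  · exact ⟨(i, true), by simp [e, signedPauli]⟩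

/-- A signed Pauli matrix as a unitary. -/
def signedPauliUnitary (s : Fin 3 × Bool) : Matrix.unitaryGroup (Fin 2) ℂ :=
  ⟨signedPauli s, by
    have h : star (signedPauli s) = signedPauli s := by
      obtain ⟨i, t⟩ := s
      ext k l
      fin_cases i <;> cases t <;> fin_cases k <;> fin_cases l <;>
        simp [signedPauli, pauliX, pauliY, pauliZ]
    rw [Matrix.mem_unitaryGroup_iff, h, signedPauli_mul_self]⟩

theorem signedPauliUnitary_mem (s : Fin 3 × Bool) : signedPauliUnitary s ∈ pauliGroup := by
  obtain ⟨i, t⟩ := s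
  refine ⟨if t then -1 else 1, by cases t <;> simp, ![pauliX, pauliY, pauliZ] i, ?_, rfl⟩
  fin_cases i <;> simp

theorem signedPauli_ne_smul_one (s : Fin 3 × Bool) (z : ℂ) : signedPauli s ≠ z • 1 := by
  intro h
  obtain ⟨i, t⟩ := s
  have h00 := congrFun (congrFun h 0) 0
  have h01 := congrFun (congrFun h 0) 1
  have h11 := congrFun (congrFun h 1) 1
  fin_cases i <;> cases t <;>
    simp [signedPauli, pauliX, pauliY, pauliZ] at h00 h01 h11
  · rw [← h00] at h11; norm_num at h11
  · rw [← h00] at h11; norm_num at h11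

theorem exists_cliffordMat_mul_signedPauli (U : cliffordOps) (s : Fin 3 × Bool) :
    ∃ t, cliffordMat U * signedPauli s = signedPauli t * cliffordMat U := by
  have hm : (U : Matrix.unitaryGroup (Fin 2) ℂ) * signedPauliUnitary s
      * (U : Matrix.unitaryGroup (Fin 2) ℂ)⁻¹ ∈ pauliGroup :=
    (U.2 _).1 (signedPauliUnitary_mem s)
  have hv : (((U : Matrix.unitaryGroup (Fin 2) ℂ) * signedPauliUnitary s
      * (U : Matrix.unitaryGroup (Fin 2) ℂ)⁻¹ : Matrix.unitaryGroup (Fin 2) ℂ) : QMat)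
      = cliffordMat U * signedPauli s * cliffordMat U⁻¹ := rfl
  have hU := cliffordMat_inv_mul U
  have hU' := cliffordMat_mul_inv U
  obtain ⟨t, ht⟩ := exists_signedPauli_of_mem hm
    (by
      rw [hv]
      calc _ = cliffordMat U * signedPauli s * (cliffordMat U⁻¹ * cliffordMat U)
            * signedPauli s * cliffordMat U⁻¹ := by simp only [mul_assoc]
        _ = 1 := by
          rw [hU, mul_one, mul_assoc (cliffordMat U), signedPauli_mul_self, mul_one, hU'])
    (by
      rw [hv]
      intro z hz
      apply signedPauli_ne_smul_one s z
      calc signedPauli s = (cliffordMat U⁻¹ * cliffordMat U) * signedPauli s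
            * (cliffordMat U⁻¹ * cliffordMat U) := by simp [hU]
        _ = cliffordMat U⁻¹ * (cliffordMat U * signedPauli s * cliffordMat U⁻¹)
            * cliffordMat U := by simp only [mul_assoc]
        _ = z • 1 := by rw [hz]; simp [hU])
  refine ⟨t, ?_⟩
  rw [← ht, hv, mul_assoc _ _ (cliffordMat U), hU, mul_one]

/-- A Clifford operator maps the anticommuting `X`, `Z` to signed Pauli matrices of different
kinds. -/
theorem fst_ne_of_cliffordMat_mul {U : cliffordOps} {p q : Fin 3 × Bool}
    (hp : cliffordMat U * signedPauli (0, false) = signedPauli p * cliffordMat U)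
    (hq : cliffordMat U * signedPauli (2, false) = signedPauli q * cliffordMat U) :
    p.1 ≠ q.1 := by
  intro h
  -- Images of the same kind agree up to sign; cancelling `U` would give `X = ±Z`.
  have hpq : p = q ∨ signedPauli p = -signedPauli q := by
    obtain ⟨i, s⟩ := p
    obtain ⟨j, t⟩ := q
    obtain rfl : i = j := h
    cases s <;> cases t <;> simp [signedPauli]
  have hc : ∀ P Q : QMat, cliffordMat U * P = cliffordMat U * Q → P = Q := by
    intro P Q h
    have := congrArg (cliffordMat U⁻¹ * ·) h
    simpa only [← mul_assoc, cliffordMat_inv_mul, one_mul] using this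
  rcases hpq with rfl | e
  · exact absurd (signedPauli_injective (hc _ _ (hp.trans hq.symm))) (by decide)
  · rw [e, neg_mul, ← hq, ← mul_neg] at hp
    have e' : -signedPauli (2, false) = signedPauli (2, true) := by simp [signedPauli]
    rw [e'] at hp
    exact absurd (signedPauli_injective (hc _ _ hp)) (by decide)

/-- A Clifford operator is determined modulo phase by what it does to `X` and `Z`. -/
theorem cliffordClass_eq_of_conj {U W : cliffordOps} {p q : Fin 3 × Bool}
    (hU : cliffordMat U * signedPauli (0, false) = signedPauli p * cliffordMat U)
    (hU' : cliffordMat U * signedPauli (2, false) = signedPauli q * cliffordMat U)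
    (hW : cliffordMat W * signedPauli (0, false) = signedPauli p * cliffordMat W)
    (hW' : cliffordMat W * signedPauli (2, false) = signedPauli q * cliffordMat W) :
    cliffordClass U = cliffordClass W := by
  symm
  refine QuotientGroup.eq.2 ?_
  -- `W⁻¹U` commutes with X and Z. Commuting with Z kills the off-diagonal entries, commuting with X
  -- equates the diagonal ones, so it is a scalar.
  have comm : ∀ P Q : QMat, cliffordMat U * P = Q * cliffordMat U →
      cliffordMat W * P = Q * cliffordMat W →
      cliffordMat (W⁻¹ * U) * P = P * cliffordMat (W⁻¹ * U) := by
    intro P Q h h'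
    rw [cliffordMat_mul, mul_assoc, h, ← mul_assoc, cliffordMat_inv_mul_of_mul h', mul_assoc]
  have h1 := comm _ _ hU hW
  have h2 := comm _ _ hU' hW'
  refine ⟨cliffordMat (W⁻¹ * U) 0 0, ?_⟩
  change cliffordMat (W⁻¹ * U) = _
  generalize cliffordMat (W⁻¹ * U) = M at h1 h2
  have a := congrFun (congrFun h1 0) 1
  have b := congrFun (congrFun h2 0) 1
  have c := congrFun (congrFun h2 1) 0
  simp [signedPauli, pauliX, pauliZ, Matrix.mul_apply] at a b c
  have b' : M 0 1 = 0 := by linear_combination (-1 / 2 : ℂ) * b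
  have c' : M 1 0 = 0 := by linear_combination (1 / 2 : ℂ) * c
  ext k l
  fin_cases k <;> fin_cases l <;> simp [a, b', c']

/-- The bridge to the finite checks: a word spells `C` as soon as it moves X and Z in the same way
as a representative does. -/
theorem exists_word_of_conj (C : LocalClifford) : ∃ U : cliffordOps, cliffordClass U = C ∧
    ∃ p q : Fin 3 × Bool, p.1 ≠ q.1 ∧
      cliffordMat U * signedPauli (0, false) = signedPauli p * cliffordMat U ∧
      ∀ w, conjWord w (0, false) = p → conjWord w (2, false) = q →
        (w.map CliffordFactor.val).prod = C := by
  obtain ⟨U, rfl⟩ := cliffordClass_surjective C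
  obtain ⟨p, hp⟩ := exists_cliffordMat_mul_signedPauli U (0, false)
  obtain ⟨q, hq⟩ := exists_cliffordMat_mul_signedPauli U (2, false)
  refine ⟨U, rfl, p, q, fst_ne_of_cliffordMat_mul hp hq, hp, ?_⟩
  rintro w rfl rfl
  rw [← class_prod_op]
  exact cliffordClass_eq_of_conj (cliffordMat_word_mul _ _) (cliffordMat_word_mul _ _) hp hq

theorem exists_isDecompositionTable : ∃ D, IsDecompositionTable D := by
  have h : ∀ C : LocalClifford, ∃ w : List CliffordFactor,
      w.length ≤ 5 ∧ (w.map CliffordFactor.val).prod = C := by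
    intro C
    obtain ⟨U, -, p, q, hpq, -, hw⟩ := exists_word_of_conj C
    obtain ⟨w, hs, h1, h2⟩ := exists_shortWord_conj p q hpq
    exact ⟨w, mem_shortWords.1 hs, hw w h1 h2⟩
  choose D hD using h
  exact ⟨D, hD⟩

/-- A short word for the identity has no letters or is the fourth power of a letter. -/
theorem map_isNegIX_of_prod_eq_one {w : List CliffordFactor} (hl : w.length ≤ 5)
    (h : (w.map CliffordFactor.val).prod = 1) :
    w.map CliffordFactor.isNegIX ∈ [[], List.replicate 4 true, List.replicate 4 false] := by
  rw [← class_prod_op] at h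
  obtain ⟨z, hz⟩ : (w.map CliffordFactor.op).prod ∈ globalPhases :=
    (QuotientGroup.eq_one_iff _).1 h
  have hz' : cliffordMat (w.map CliffordFactor.op).prod = z • 1 := hz
  have h0 : z ≠ 0 := by
    rintro rfl
    have := cliffordMat_inv_mul (w.map CliffordFactor.op).prod
    rw [hz'] at this
    simpa using congrFun (congrFun this 0) 0
  have key : ∀ s, conjWord w s = s := by
    intro s
    have := cliffordMat_word_mul w s
    rw [hz'] at this
    simp only [Matrix.smul_mul, one_mul, Matrix.mul_smul, mul_one] at this
    exact (signedPauli_injective (smul_right_injective _ h0 this)).symm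
  exact shortWord_trivial_conj w (mem_shortWords.2 hl) (key _) (key _)

/-! ### The diagonal vertex operators `𝒵` and the operators sending X to `±Z` -/

theorem sqrtNegIZ_eq_phase : sqrtNegIZ = cliffordClass phaseOp := by
  symm
  -- The scalar is `exp(-iπ/4)`, from `√(-iZ) = exp(-iπ/4) S`.
  refine QuotientGroup.eq.2 ⟨((Real.sqrt 2 : ℝ) : ℂ)⁻¹ * (1 - Complex.I), ?_⟩
  change star phaseMat * sqrtNegIZMat = _
  rw [sqrtNegIZMat_eq]
  have hI := Complex.I_mul_I
  ext k l
  fin_cases k <;> fin_cases l <;> (simp [phaseMat, Matrix.mul_apply]; try grind)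

theorem class_zOp : cliffordClass zOp = sqrtNegIZ ^ 2 := by
  rw [sqrtNegIZ_eq_phase, pow_two, ← cliffordClass_mul]
  congr 1
  apply Subtype.ext
  apply Subtype.ext
  change pauliZ = phaseMat * phaseMat
  ext i j
  fin_cases i <;> fin_cases j <;> simp [phaseMat, pauliZ, Matrix.mul_apply]

theorem sqrtNegIZ_pow_four : sqrtNegIZ ^ 4 = 1 := by
  rw [show 4 = 2 * 2 from rfl, pow_mul, ← class_zOp, pow_two, ← cliffordClass_mul]
  have : zOp * zOp = 1 := by
    apply Subtype.ext
    apply Subtype.ext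
    change pauliZ * pauliZ = 1
    ext i j
    fin_cases i <;> fin_cases j <;> simp [pauliZ, Matrix.mul_apply]
  rw [this]
  rfl

/-- The elements of `𝒵` are the powers of the phase gate. -/
theorem mem_zSet_iff {C : LocalClifford} : C ∈ zSet ↔ ∃ k : ℕ, C = sqrtNegIZ ^ k := by
  have e : (cliffordClass phaseOp⁻¹ : LocalClifford) = sqrtNegIZ ^ 3 := by
    have h : cliffordClass phaseOp⁻¹ = sqrtNegIZ⁻¹ := by rw [sqrtNegIZ_eq_phase]; rfl
    rw [h, inv_eq_iff_mul_eq_one, ← pow_succ', sqrtNegIZ_pow_four]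
  unfold zSet
  rw [class_zOp, ← sqrtNegIZ_eq_phase, e]
  constructor
  · rintro (rfl | rfl | rfl | rfl)
    · exact ⟨0, (pow_zero _).symm⟩
    · exact ⟨2, rfl⟩
    · exact ⟨1, (pow_one _).symm⟩
    · exact ⟨3, rfl⟩
  · rintro ⟨k, rfl⟩
    rw [pow_eq_pow_mod k sqrtNegIZ_pow_four]
    have : k % 4 < 4 := Nat.mod_lt _ (by norm_num)
    interval_cases k % 4 <;> simp

theorem one_mem_zSet : 1 ∈ zSet := mem_zSet_iff.2 ⟨0, (pow_zero _).symm⟩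

theorem sqrtNegIZ_mem_zSet : sqrtNegIZ ∈ zSet := mem_zSet_iff.2 ⟨1, (pow_one _).symm⟩

theorem class_zOp_mem_zSet : cliffordClass zOp ∈ zSet := mem_zSet_iff.2 ⟨2, class_zOp⟩

theorem mul_mem_zSet {C C' : LocalClifford} (h : C ∈ zSet) (h' : C' ∈ zSet) : C * C' ∈ zSet := by
  obtain ⟨k, rfl⟩ := mem_zSet_iff.1 h
  obtain ⟨l, rfl⟩ := mem_zSet_iff.1 h'
  exact mem_zSet_iff.2 ⟨k + l, (pow_add _ _ _).symm⟩

theorem sqrtIZ_mem_zSet : sqrtIZ ∈ zSet := by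
  refine mem_zSet_iff.2 ⟨3, ?_⟩
  rw [sqrtIZ, inv_eq_iff_mul_eq_one, ← pow_succ', sqrtNegIZ_pow_four]

/-- All representatives of an element of `𝒵` are diagonal. -/
theorem cliffordMat_offDiag_of_mem_zSet {U : cliffordOps} (h : cliffordClass U ∈ zSet)
    {i j : Fin 2} (hij : i ≠ j) : cliffordMat U i j = 0 := by
  have key : ∃ W : cliffordOps, cliffordClass W = cliffordClass U ∧
      ∀ i j : Fin 2, i ≠ j → cliffordMat W i j = 0 := by
    obtain ⟨k, hk⟩ := mem_zSet_iff.1 h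
    refine ⟨phaseOp ^ k, by rw [hk, sqrtNegIZ_eq_phase]; rfl, ?_⟩
    have : cliffordMat (phaseOp ^ k) = Matrix.diagonal ![1, Complex.I] ^ k := by
      have e : cliffordMat phaseOp = Matrix.diagonal ![1, Complex.I] := by
        change phaseMat = _
        ext i j
        fin_cases i <;> fin_cases j <;> simp [phaseMat]
      rw [← e]
      rfl
    rw [this, Matrix.diagonal_pow]
    intro i j hij
    exact Matrix.diagonal_apply_ne _ hij
  obtain ⟨W, hW, hd⟩ := key
  obtain ⟨z, hz⟩ : W⁻¹ * U ∈ globalPhases := QuotientGroup.eq.1 hW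
  have e : cliffordMat U = cliffordMat W * cliffordMat (W⁻¹ * U) := by
    rw [← cliffordMat_mul]; congr 1; group
  have hz' : cliffordMat (W⁻¹ * U) = z • 1 := hz
  rw [e, hz']
  simp [hd i j hij]

/-- The local Clifford operators `C` with `C X C† = ±Z`. -/
def MapsXToZ (C : LocalClifford) : Prop :=
  ∃ U : cliffordOps, cliffordClass U = C ∧ ∃ ε : ℂ, (ε = 1 ∨ ε = -1) ∧
    cliffordMat U * pauliX = ε • pauliZ * cliffordMat U

/-- Unless `C` sends X to `±Z`, it is a power of `√(iZ)` times a power of `√(-iX)`, and right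
multiplication by `√(iX)`, which complementing about the vertex performs, removes the latter. -/
theorem mapsXToZ_or_exists_mul_sqrtIX_pow (C : LocalClifford) :
    MapsXToZ C ∨ ∃ k : ℕ, C * sqrtIX ^ k ∈ zSet := by
  obtain ⟨U, hU, p, q, hpq, hp, hw⟩ := exists_word_of_conj C
  by_cases h2 : p.1 = 2
  · left
    refine ⟨U, hU, if p.2 then -1 else 1, ?_, ?_⟩
    · split_ifs <;> simp
    · simpa [signedPauli, h2] using hp
  · right
    obtain ⟨j, -, k, -, h1, h2⟩ := exists_conj_posIZ_negIX p q hpq h2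
    refine ⟨k, ?_⟩
    rw [← hw _ h1 h2]
    simp only [List.map_append, List.map_replicate, List.prod_append, List.prod_replicate,
      CliffordFactor.val, sqrtNegIX, inv_pow, inv_mul_cancel_right]
    clear h1 h2
    induction j with
    | zero => exact one_mem_zSet
    | succ j ih => rw [pow_succ]; exact mul_mem_zSet ih sqrtIZ_mem_zSet

end

noncomputable section

/-! ### Graph states and vertex operators -/

section Signs

variable {V : Type*}

/-- The sign of the basis state `x` in the graph state of `G`. -/
def graphSign [Fintype V] [DecidableEq V] (G : SimpleGraph V) (x : V → Fin 2) : ℂ :=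
  open Classical in ∏ e ∈ G.edgeFinset, czSign e x

theorem graphState_eq_graphSign [Fintype V] [DecidableEq V] (G : SimpleGraph V) (x : V → Fin 2) :
    graphState G x = graphSign G x * (((Real.sqrt 2 : ℝ) : ℂ)⁻¹) ^ Fintype.card V :=
  graphState_apply G x

theorem czSign_mul_self (e : Sym2 V) (x : V → Fin 2) : czSign e x * czSign e x = 1 := by
  unfold czSign
  split_ifs <;> simp

/-- The sign of the controlled phase gate as a function of the two bits. -/
def czBits (i j : Fin 2) : ℂ := if i = 1 ∧ j = 1 then -1 else 1

theorem czSign_mk (a b : V) (x : V → Fin 2) : czSign s(a, b) x = czBits (x a) (x b) := by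
  simp [czSign, czBits]

theorem graphSign_eq_prod [Fintype V] [DecidableEq V] {G : SimpleGraph V} {p : Sym2 V → Prop} [DecidablePred p]
    (hp : ∀ e, e ∈ G.edgeSet ↔ p e) (x : V → Fin 2) :
    graphSign G x = ∏ e : Sym2 V, if p e then czSign e x else 1 := by
  rw [graphSign, ← Finset.prod_filter]
  refine Finset.prod_congr ?_ fun _ _ => rfl
  ext e
  simp [hp]

theorem mem_edgeSet_symmDiff (G H : SimpleGraph V) (e : Sym2 V) :
    e ∈ (G ∆ H).edgeSet ↔ (e ∈ G.edgeSet ∧ e ∉ H.edgeSet ∨ e ∈ H.edgeSet ∧ e ∉ G.edgeSet) := by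
  induction e with
  | _ p q => simp [symmDiff_def]

/-- Edge signs square to 1, so the edges common to both graphs cancel. This handles edge toggling
and local complementation alike. -/
theorem graphSign_symmDiff [Fintype V] [DecidableEq V] (G H : SimpleGraph V) (x : V → Fin 2) :
    graphSign (G ∆ H) x = graphSign G x * graphSign H x := by
  classical
  rw [graphSign_eq_prod (mem_edgeSet_symmDiff G H), graphSign_eq_prod fun _ => Iff.rfl,
    graphSign_eq_prod (G := H) fun _ => Iff.rfl, ← Finset.prod_mul_distrib]
  refine Finset.prod_congr rfl fun e _ => ?_
  have := czSign_mul_self e x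
  by_cases h1 : e ∈ G.edgeSet <;> by_cases h2 : e ∈ H.edgeSet <;> simp [h1, h2, this]

theorem graphSign_edge [Fintype V] [DecidableEq V] {a b : V} (hab : a ≠ b) (x : V → Fin 2) :
    graphSign (SimpleGraph.edge a b) x = czSign s(a, b) x := by
  classical
  rw [graphSign_eq_prod (p := (· = s(a, b))) fun e => by
    rw [SimpleGraph.edgeSet_edge_of_ne hab, Set.mem_singleton_iff]]
  simp

theorem graphSign_bot [Fintype V] [DecidableEq V] (x : V → Fin 2) : graphSign (⊥ : SimpleGraph V) x = 1 := by
  rw [graphSign_eq_prod (p := fun _ => False) (by simp)]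
  simp

/-- The sign of the complete graph on a set of vertices depends on the number of ones. -/
theorem graphSign_fromEdgeSet_pairs [Fintype V] [DecidableEq V] (G : SimpleGraph V) (a : V) (x : V → Fin 2) :
    graphSign (SimpleGraph.fromEdgeSet
      {e | ∃ b ∈ G.neighborSet a, ∃ c ∈ G.neighborSet a, e = s(b, c)}) x
      = (-1) ^ (open Classical in
          (Finset.univ.filter fun v => G.Adj a v ∧ x v = 1).card).choose 2 := by
  classical
  -- The binomial coefficient counts the unordered pairs of distinct neighbours with bit 1, and
  -- exactly these contribute `-1`.
  rw [← Sym2.card_image_offDiag, graphSign_eq_prod fun _ => Iff.rfl, ← Finset.prod_const]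
  have h : ∀ e : Sym2 V, (if e ∈ (SimpleGraph.fromEdgeSet
      {e | ∃ b ∈ G.neighborSet a, ∃ c ∈ G.neighborSet a, e = s(b, c)}).edgeSet
        then czSign e x else 1)
      = if e ∈ ((Finset.univ.filter fun v => G.Adj a v ∧ x v = 1).offDiag).image Sym2.mk.uncurry
        then -1 else 1 := by
    intro e
    induction e with
    | _ p q =>
      have e1 : (s(p, q) ∈ (SimpleGraph.fromEdgeSet
          {e | ∃ b ∈ G.neighborSet a, ∃ c ∈ G.neighborSet a, e = s(b, c)}).edgeSet) ↔
          G.Adj a p ∧ G.Adj a q ∧ p ≠ q := by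
        simp only [SimpleGraph.mem_edgeSet, SimpleGraph.fromEdgeSet_adj, Set.mem_ofPred_eq,
          SimpleGraph.mem_neighborSet, Sym2.eq_iff]
        constructor
        · rintro ⟨⟨b, hb, c, hc, ⟨rfl, rfl⟩ | ⟨rfl, rfl⟩⟩, h⟩
          · exact ⟨hb, hc, h⟩
          · exact ⟨hc, hb, h⟩
        · rintro ⟨h1, h2, h3⟩
          exact ⟨⟨p, h1, q, h2, Or.inl ⟨rfl, rfl⟩⟩, h3⟩
      have e2 : (s(p, q) ∈ ((Finset.univ.filter fun v =>
          G.Adj a v ∧ x v = 1).offDiag).image Sym2.mk.uncurry) ↔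
          (G.Adj a p ∧ x p = 1) ∧ (G.Adj a q ∧ x q = 1) ∧ p ≠ q := by
        simp only [Finset.mem_image, Finset.mem_offDiag, Finset.mem_filter, Finset.mem_univ,
          true_and, Prod.exists, Function.uncurry, Sym2.eq_iff]
        constructor
        · rintro ⟨b, c, ⟨hb, hc, h⟩, ⟨rfl, rfl⟩ | ⟨rfl, rfl⟩⟩
          · exact ⟨hb, hc, h⟩
          · exact ⟨hc, hb, h.symm⟩
        · rintro ⟨h1, h2, h3⟩
          exact ⟨p, q, ⟨h1, h2, h3⟩, Or.inl ⟨rfl, rfl⟩⟩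
      rw [czSign_mk, czBits]
      simp only [e1, e2]
      by_cases h1 : G.Adj a p <;> by_cases h2 : G.Adj a q <;> by_cases h3 : p = q <;>
        simp [h1, h2, h3]
  refine (Finset.prod_congr rfl fun e _ => ?_).trans (b := ∏ e : Sym2 V, if e ∈
    ((Finset.univ.filter fun v => G.Adj a v ∧ x v = 1).offDiag).image Sym2.mk.uncurry
      then (-1 : ℂ) else 1) ?_
  · convert h e
  · rw [← Finset.prod_filter, Finset.filter_mem_eq_inter, Finset.univ_inter]

theorem vopState_apply [Fintype V] [DecidableEq V] (G : SimpleGraph V) (C : V → cliffordOps) (x : V → Fin 2) :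
    vopState G C x = ∑ y, (∏ v, cliffordMat (C v) (x v) (y v)) *
      (graphSign G y * (((Real.sqrt 2 : ℝ) : ℂ)⁻¹) ^ Fintype.card V) := by
  simp only [← graphState_eq_graphSign]
  rfl

theorem tensorOp_mul [Fintype V] [DecidableEq V] (A B : V → QMat) : tensorOp A * tensorOp B = tensorOp fun v => A v * B v := by
  ext x y
  simp only [tensorOp, Matrix.mul_apply, Matrix.of_apply, ← Finset.prod_mul_distrib]
  exact (Fintype.prod_sum (f := fun v j => A v (x v) j * B v j (y v))).symm

theorem controlledZ_mulVec [Fintype V] [DecidableEq V] (a b : V) (ψ : QState V) (x : V → Fin 2) :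
    Matrix.mulVec (controlledZ a b) ψ x = czSign s(a, b) x * ψ x :=
  Matrix.mulVec_diagonal _ _ _

theorem controlledZ_comm [Fintype V] [DecidableEq V] (a b : V) : controlledZ a b = controlledZ b a := by
  rw [controlledZ, controlledZ, Sym2.eq_swap]

theorem EqUpToPhase.symm {φ ψ : QState V} (h : EqUpToPhase φ ψ) : EqUpToPhase ψ φ := by
  obtain ⟨z, hz, rfl⟩ := h
  have hz0 : z ≠ 0 := by
    rintro rfl
    simp at hz
  exact ⟨z⁻¹, by simp [hz], by rw [smul_smul, inv_mul_cancel₀ hz0, one_smul]⟩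

theorem EqUpToPhase.trans {φ ψ χ : QState V} (h : EqUpToPhase φ ψ) (h' : EqUpToPhase ψ χ) :
    EqUpToPhase φ χ := by
  obtain ⟨z, hz, rfl⟩ := h
  obtain ⟨w, hw, rfl⟩ := h'
  exact ⟨z * w, by simp [hz, hw], by rw [smul_smul]⟩

theorem EqUpToPhase.mulVec [Fintype V] [DecidableEq V] {φ ψ : QState V} (h : EqUpToPhase φ ψ) (A : QOp V) :
    EqUpToPhase (Matrix.mulVec A φ) (Matrix.mulVec A ψ) := by
  obtain ⟨z, hz, rfl⟩ := h
  exact ⟨z, hz, Matrix.mulVec_smul _ _ _⟩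

namespace GraphRegister

/-- `Represents` quantifies over all representatives; since they differ by phases only, one choice
suffices. -/
theorem represents_of_eqUpToPhase [Fintype V] [DecidableEq V] {r : GraphRegister V} {ψ : QState V} {C : V → cliffordOps}
    (hC : ∀ v, cliffordClass (C v) = r.vop v) (h : EqUpToPhase ψ (vopState r.graph C)) :
    r.Represents ψ := by
  intro C' hC'
  have hr : (⟨r.graph, fun v => cliffordClass (C v)⟩ : GraphRegister V) = r := by
    obtain ⟨G, f⟩ := r
    simp only [GraphRegister.mk.injEq, true_and]
    exact funext hC
  have := represents_vopState r.graph C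
  rw [hr] at this
  exact h.trans (this C' hC')

/-- Choice of representatives of the vertex operators. -/
theorem exists_representatives (r : GraphRegister V) :
    ∃ C : V → cliffordOps, ∀ v, cliffordClass (C v) = r.vop v := by
  choose C hC using fun v => cliffordClass_surjective (r.vop v)
  exact ⟨C, hC⟩

/-- Toggling an edge between two vertices with diagonal vertex operators performs the phase
gate. -/
theorem Represents.toggleEdge [Fintype V] [DecidableEq V] {r : GraphRegister V} {ψ : QState V} (h : r.Represents ψ) {a b : V}
    (hab : a ≠ b) (ha : r.vop a ∈ zSet) (hb : r.vop b ∈ zSet) :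
    (r.toggleEdge a b).Represents (Matrix.mulVec (controlledZ a b) ψ) := by
  intro C hC
  refine ((h C hC).mulVec _).trans ⟨1, by simp, ?_⟩
  rw [one_smul]
  funext x
  rw [controlledZ_mulVec, vopState_apply, vopState_apply, Finset.mul_sum]
  refine Finset.sum_congr rfl fun y _ => ?_
  have ha' : cliffordClass (C a) ∈ zSet := by rw [hC]; exact ha
  have hb' : cliffordClass (C b) ∈ zSet := by rw [hC]; exact hb
  -- Diagonal VOPs kill every term in which `y` differs from `x` at `a` or `b`; in the others the
  -- sign of the gate is that of the toggled edge.
  by_cases h1 : x a = y a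
  · by_cases h2 : x b = y b
    · change _ = _ * (graphSign (r.graph ∆ SimpleGraph.edge a b) y * _)
      rw [graphSign_symmDiff, graphSign_edge hab, czSign_mk, czSign_mk, h1, h2]
      ring
    · rw [Finset.prod_eq_zero (Finset.mem_univ b) (cliffordMat_offDiag_of_mem_zSet hb' h2)]
      simp
  · rw [Finset.prod_eq_zero (Finset.mem_univ a) (cliffordMat_offDiag_of_mem_zSet ha' h1)]
    simp

end GraphRegister

/-! ### Local complementation of graph states -/

/-- The interference identity behind local complementation, with `k` the number of neighbours of the
centre that have bit 1. The first two factors give 1 for even `k` and `i` for odd `k`, and `i(1 - i)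
= 1 + i`. -/
theorem I_pow_mul_neg_one_pow_choose (k : ℕ) :
    Complex.I ^ k * (-1) ^ k.choose 2 * (1 + Complex.I * (-1) ^ k) = 1 + Complex.I := by
  induction k using Nat.twoStepInduction with
  | zero => simp
  | one =>
    simp
    linear_combination -Complex.I_mul_I
  | more k ih _ =>
    have e : (k + 2).choose 2 = k.choose 2 + (2 * k + 1) := by
      rw [Nat.choose_succ_succ' (k + 1) 1, Nat.choose_succ_succ' k 1]
      simp
      ring
    rw [← ih, e, pow_add, pow_add, pow_add, pow_add, pow_mul]
    simp

/-- The local unitary that undoes a local complementation about `a`. -/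
def localComplementationOp (G : SimpleGraph V) (a v : V) : cliffordOps :=
  open Classical in if v = a then sqrtIXOp else if G.Adj a v then sqrtNegIZOp else 1

theorem prod_sqrtNegIZ (s : Finset V) (x : V → Fin 2) :
    ∏ v ∈ s, sqrtNegIZMat (x v) (x v)
      = (((Real.sqrt 2 : ℝ) : ℂ)⁻¹ * (1 - Complex.I)) ^ s.card
        * Complex.I ^ (s.filter fun v => x v = 1).card := by
  have h : ∀ v, sqrtNegIZMat (x v) (x v) = ((Real.sqrt 2 : ℝ) : ℂ)⁻¹ * (1 - Complex.I)
      * if x v = 1 then Complex.I else 1 := by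
    intro v
    rw [sqrtNegIZMat_eq]
    generalize x v = i
    have hI := Complex.I_mul_I
    fin_cases i <;> simp
    grind
  rw [Finset.prod_congr rfl fun v _ => h v, Finset.prod_mul_distrib, Finset.prod_const,
    ← Finset.prod_filter, Finset.prod_const]

theorem norm_sqrt_two_inv_mul_one_sub_I :
    ‖((Real.sqrt 2 : ℝ) : ℂ)⁻¹ * (1 - Complex.I)‖ = 1 := by
  have : ‖(1 - Complex.I : ℂ)‖ = Real.sqrt 2 := by
    rw [Complex.norm_def]
    congr 1
    norm_num [Complex.normSq_apply]
  rw [norm_mul, this, norm_inv, Complex.norm_real, Real.norm_of_nonneg (Real.sqrt_nonneg 2)]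
  exact inv_mul_cancel₀ (by positivity)

theorem norm_sqrt_two_inv_mul_one_add_I :
    ‖((Real.sqrt 2 : ℝ) : ℂ)⁻¹ * (1 + Complex.I)‖ = 1 := by
  have : ‖(1 + Complex.I : ℂ)‖ = Real.sqrt 2 := by
    rw [Complex.norm_def]
    congr 1
    norm_num [Complex.normSq_apply]
  rw [norm_mul, this, norm_inv, Complex.norm_real, Real.norm_of_nonneg (Real.sqrt_nonneg 2)]
  exact inv_mul_cancel₀ (by positivity)

theorem graphSign_update [Fintype V] [DecidableEq V] (G : SimpleGraph V) (a : V) (x : V → Fin 2) :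
    graphSign G (Function.update x a (x a + 1))
      = (open Classical in ∏ v, if G.Adj a v ∧ x v = 1 then (-1 : ℂ) else 1) * graphSign G x := by
  classical
  unfold graphSign
  rw [prod_czSign_update G a x, ← mul_assoc, ← Finset.prod_mul_distrib]
  have h : ∀ v, ((if G.Adj a v ∧ x v = 1 then (-1 : ℂ) else 1)
      * if G.Adj a v ∧ x v = 1 then (-1 : ℂ) else 1) = 1 := by
    intro v
    split_ifs <;> simp
  simp [h]

/-- Local complementation changes the graph state by local Clifford operators. -/
theorem vopState_localComplement [Fintype V] [DecidableEq V] (G : SimpleGraph V) (a : V) :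
    EqUpToPhase (vopState (localComplement G a) (localComplementationOp G a)) (graphState G) := by
  classical
  set N := Finset.univ.filter fun v => G.Adj a v with hN
  -- The phase is `exp(iπ/4)` from the interference at `a`, times `exp(-iπ/4)` for each neighbour.
  refine ⟨((Real.sqrt 2 : ℝ) : ℂ)⁻¹ * (1 + Complex.I)
    * (((Real.sqrt 2 : ℝ) : ℂ)⁻¹ * (1 - Complex.I)) ^ N.card, ?_, ?_⟩
  · rw [norm_mul, norm_pow, norm_sqrt_two_inv_mul_one_sub_I, norm_sqrt_two_inv_mul_one_add_I]
    simp
  funext x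
  set k := (Finset.univ.filter fun v => G.Adj a v ∧ x v = 1).card with hk
  have hmat : ∀ v, v ≠ a → ∀ i j : Fin 2, i ≠ j →
      cliffordMat (localComplementationOp G a v) i j = 0 := by
    intro v hv i j hij
    refine cliffordMat_offDiag_of_mem_zSet ?_ hij
    unfold localComplementationOp
    rw [if_neg hv]
    split_ifs
    · exact sqrtNegIZ_mem_zSet
    · exact one_mem_zSet
  have hprod : ∏ v ∈ Finset.univ.erase a, cliffordMat (localComplementationOp G a v) (x v) (x v)
      = (((Real.sqrt 2 : ℝ) : ℂ)⁻¹ * (1 - Complex.I)) ^ N.card * Complex.I ^ k := by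
    have e : k = (N.filter fun v => x v = 1).card := by rw [hk, hN, Finset.filter_filter]
    rw [e, ← prod_sqrtNegIZ]
    symm
    refine Finset.prod_subset_one_on_sdiff ?_ ?_ ?_
    · intro v hv
      have : G.Adj a v := by simpa [hN] using hv
      simp [this.ne']
    · intro v hv
      have : v ≠ a ∧ ¬ G.Adj a v := by simpa [hN] using hv
      simp [localComplementationOp, this.1, this.2, cliffordMat_one]
    · intro v hv
      have h : G.Adj a v := by simpa [hN] using hv
      simp only [localComplementationOp, if_neg h.ne', if_pos h]
      rfl
  -- The operators are diagonal away from `a`, and `√(iX)` at `a` mixes `x` only with its flip at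
  -- `a`.
  have hsum : ∀ g : (V → Fin 2) → ℂ,
      ∑ y, (∏ v, cliffordMat (localComplementationOp G a v) (x v) (y v)) * g y
      = (((Real.sqrt 2 : ℝ) : ℂ)⁻¹ * (1 - Complex.I)) ^ N.card * Complex.I ^ k
        * ((Real.sqrt 2 : ℝ) : ℂ)⁻¹
        * (g x + Complex.I * g (Function.update x a (x a + 1))) := by
    intro g
    have hne : x ≠ Function.update x a (x a + 1) := by
      intro h
      have := congrFun h a
      simp at this
    have ha1 : localComplementationOp G a a = sqrtIXOp := by simp [localComplementationOp]
    have hm : cliffordMat sqrtIXOp = sqrtIXMat := rfl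
    rw [Finset.sum_eq_add_of_mem x (Function.update x a (x a + 1)) (Finset.mem_univ _)
      (Finset.mem_univ _) hne]
    · rw [← Finset.mul_prod_erase _ _ (Finset.mem_univ a), hprod,
        ← Finset.mul_prod_erase _ _ (Finset.mem_univ a),
        Finset.prod_congr rfl (g := fun v =>
          cliffordMat (localComplementationOp G a v) (x v) (x v)), hprod, ha1, hm, sqrtIXMat_eq]
      · rw [Function.update_self]
        generalize x a = i
        fin_cases i <;> simp <;> ring
      · intro v hv
        rw [Function.update_of_ne (Finset.ne_of_mem_erase hv)]
    · intro y _ hy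
      have : ∃ v, v ≠ a ∧ x v ≠ y v := by
        by_contra! hc
        rcases eq_or_ne (y a) (x a) with h | h
        · refine hy.1 (funext fun v => ?_)
          by_cases hv : v = a
          · rw [hv, h]
          · exact (hc v hv).symm
        · refine hy.2 (funext fun v => ?_)
          by_cases hv : v = a
          · subst hv
            rw [Function.update_self]
            generalize x v = i at *
            generalize y v = j at *
            fin_cases i <;> fin_cases j <;> simp_all
          · rw [Function.update_of_ne hv, hc v hv]
      obtain ⟨v, hv, hxy⟩ := this
      rw [Finset.prod_eq_zero (Finset.mem_univ v) (hmat v hv _ _ hxy), zero_mul]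
  -- No toggled pair contains `a`, so both interfering terms get the same sign, given by the same
  -- `k`.
  have hsgn : ∀ y : V → Fin 2, (∀ v, v ≠ a → y v = x v) →
      graphSign (localComplement G a) y = graphSign G y * (-1) ^ k.choose 2 := by
    intro y hy
    rw [localComplement, graphSign_symmDiff, graphSign_fromEdgeSet_pairs]
    congr 3
    rw [hk]
    congr 1
    ext v
    simp only [Finset.mem_filter, Finset.mem_univ, true_and]
    refine and_congr_right fun h => ?_
    rw [hy v h.ne']
  have hflip : graphSign G (Function.update x a (x a + 1)) = (-1) ^ k * graphSign G x := by
    rw [graphSign_update, ← Finset.prod_filter, Finset.prod_const]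
  rw [vopState_apply, hsum, Pi.smul_apply, graphState_eq_graphSign, hsgn x fun _ _ => rfl,
    hsgn _ fun v hv => Function.update_of_ne hv _ _, hflip, smul_eq_mul]
  have := I_pow_mul_neg_one_pow_choose k
  linear_combination (((Real.sqrt 2 : ℝ) : ℂ)⁻¹ * (1 - Complex.I)) ^ N.card
    * ((Real.sqrt 2 : ℝ) : ℂ)⁻¹ * graphSign G x
    * (((Real.sqrt 2 : ℝ) : ℂ)⁻¹) ^ Fintype.card V * this

end Signs

/-! ### Local complementation and reduction of vertex operators -/

theorem localComplement_adj {V : Type*} (G : SimpleGraph V) (a v w : V) :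
    (localComplement G a).Adj v w ↔
      (G.Adj v w ∧ ¬ (G.Adj a v ∧ G.Adj a w) ∨ ¬ G.Adj v w ∧ G.Adj a v ∧ G.Adj a w ∧ v ≠ w) := by
  have h : (∃ b ∈ G.neighborSet a, ∃ c ∈ G.neighborSet a, s(v, w) = s(b, c)) ↔
      G.Adj a v ∧ G.Adj a w := by
    simp only [SimpleGraph.mem_neighborSet, Sym2.eq_iff]
    constructor
    · rintro ⟨b, hb, c, hc, ⟨rfl, rfl⟩ | ⟨rfl, rfl⟩⟩
      · exact ⟨hb, hc⟩
      · exact ⟨hc, hb⟩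
    · rintro ⟨h1, h2⟩
      exact ⟨v, h1, w, h2, Or.inl ⟨rfl, rfl⟩⟩
  have hne : G.Adj v w → v ≠ w := fun h => h.ne
  simp only [localComplement, symmDiff_def, SimpleGraph.sup_adj, SimpleGraph.sdiff_adj,
    SimpleGraph.fromEdgeSet_adj, Set.mem_ofPred_eq, h]
  tauto

/-- The centre is not its own neighbour, so no toggled pair contains it. This is why the edge to the
swapping partner survives a reduction. -/
theorem localComplement_adj_self {V : Type*} (G : SimpleGraph V) (a v : V) :
    (localComplement G a).Adj a v ↔ G.Adj a v := by
  simp [localComplement_adj]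

theorem localComplement_localComplement {V : Type*} (G : SimpleGraph V) (a : V) :
    localComplement (localComplement G a) a = G := by
  ext v w
  rw [localComplement_adj, localComplement_adj_self, localComplement_adj_self,
    localComplement_adj]
  have hne : G.Adj v w → v ≠ w := fun h => h.ne
  tauto

namespace GraphRegister

section

variable {V : Type*}

theorem localComplementation_vop_self (r : GraphRegister V) (a : V) :
    (r.localComplementation a).vop a = r.vop a * sqrtIX := by
  simp [localComplementation]

theorem localComplementation_vop_of_adj (r : GraphRegister V) {a v : V} (h : r.graph.Adj a v) :
    (r.localComplementation a).vop v = r.vop v * sqrtNegIZ := by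
  simp [localComplementation, h, h.ne']

theorem localComplementation_vop_of_ne (r : GraphRegister V) {a v : V} (h : v ≠ a) :
    ∃ q ∈ zSet, (r.localComplementation a).vop v = r.vop v * q := by
  by_cases h' : r.graph.Adj a v
  · exact ⟨sqrtNegIZ, sqrtNegIZ_mem_zSet, r.localComplementation_vop_of_adj h'⟩
  · exact ⟨1, one_mem_zSet, by simp [localComplementation, h, h']⟩

theorem localComplementation_adj_self (r : GraphRegister V) (a v : V) :
    (r.localComplementation a).graph.Adj a v ↔ r.graph.Adj a v :=
  localComplement_adj_self _ _ _

end

/-- Up to phase the old graph state is a product of local Clifford operators applied to the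
complemented one; these are absorbed into the VOPs from the right. -/
theorem Represents.localComplementation {V : Type*} [Fintype V] [DecidableEq V]
    {r : GraphRegister V} {ψ : QState V} (h : r.Represents ψ) (a : V) :
    (r.localComplementation a).Represents ψ := by
  obtain ⟨C, hC⟩ := r.exists_representatives
  refine represents_of_eqUpToPhase
    (C := fun v => C v * localComplementationOp r.graph a v) ?_ ?_
  · intro v
    rw [cliffordClass_mul, hC]
    simp only [GraphRegister.localComplementation, localComplementationOp]
    split_ifs
    · rfl
    · rfl
    · exact mul_one _
  · refine (h C hC).trans ?_
    have := (vopState_localComplement r.graph a).symm.mulVec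
      (tensorOp fun v => cliffordMat (C v))
    rw [vopState, Matrix.mulVec_mulVec, tensorOp_mul] at this
    exact this

/-- The centre of the local complementation that removes the factor `f` from the vertex operator
of `a`. -/
def factorCenter {V : Type*} (a c : V) : CliffordFactor → V
  | .negIX => a
  | .posIZ => c

theorem reduceVOP_eq {V : Type*} (D : LocalClifford → List CliffordFactor) (r : GraphRegister V)
    (a c : V) : r.reduceVOP D a c
      = ((D (r.vop a)).reverse.map (factorCenter a c)).foldl localComplementation r := by
  unfold reduceVOP reductionCenters
  congr 2

/-- The invariant is that `l`, read backwards, spells the VOP of `a`. The head of `l` is thus the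
last factor: it is cancelled by `√(iX)` if the centre is `a`, and by `√(-iZ)` if the centre is `c`,
because `a` is still a neighbour of `c`. A vertex that is never a centre only collects elements of
`𝒵`. -/
theorem foldl_localComplementation_vop {V : Type*} {a c : V} (l : List CliffordFactor)
    (r : GraphRegister V) (hac : r.graph.Adj a c)
    (hl : (l.reverse.map CliffordFactor.val).prod = r.vop a) :
    ((l.map (factorCenter a c)).foldl localComplementation r).vop a = 1 ∧
    ((l.map (factorCenter a c)).foldl localComplementation r).graph.Adj a c ∧
    ∀ v, v ≠ a → v ≠ c → ∃ q ∈ zSet,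
      ((l.map (factorCenter a c)).foldl localComplementation r).vop v = r.vop v * q := by
  induction l generalizing r with
  | nil => exact ⟨by simpa using hl.symm, hac, fun v _ _ => ⟨1, one_mem_zSet, by simp⟩⟩
  | cons f l ih =>
    simp only [List.map_cons, List.foldl_cons]
    simp only [List.reverse_cons, List.map_append, List.map_cons, List.map_nil, List.prod_append,
      List.prod_singleton] at hl
    have hadj : (r.localComplementation (factorCenter a c f)).graph.Adj a c := by
      cases f
      · exact (r.localComplementation_adj_self a c).2 hac
      · exact ((r.localComplementation_adj_self c a).2 hac.symm).symm
    have hvop : (r.localComplementation (factorCenter a c f)).vop a = r.vop a * f.val⁻¹ := by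
      cases f
      · simp [factorCenter, localComplementation_vop_self, CliffordFactor.val, sqrtNegIX]
      · simp [factorCenter, localComplementation_vop_of_adj _ hac.symm, CliffordFactor.val, sqrtIZ]
    obtain ⟨h1, h2, h3⟩ := ih _ hadj (by rw [hvop, ← hl, mul_inv_cancel_right])
    refine ⟨h1, h2, fun v hva hvc => ?_⟩
    obtain ⟨q, hq, e⟩ := h3 v hva hvc
    have hv : v ≠ factorCenter a c f := by cases f <;> assumption
    obtain ⟨q', hq', e'⟩ := r.localComplementation_vop_of_ne hv
    exact ⟨q' * q, mul_mem_zSet hq' hq, by rw [e, e', mul_assoc]⟩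

theorem reduceVOP_vop {V : Type*} {D : LocalClifford → List CliffordFactor}
    (hD : IsDecompositionTable D) (r : GraphRegister V) {a c : V} (hac : r.graph.Adj a c) :
    (r.reduceVOP D a c).vop a = 1 ∧ (r.reduceVOP D a c).graph.Adj a c ∧
    ∀ v, v ≠ a → v ≠ c → ∃ q ∈ zSet, (r.reduceVOP D a c).vop v = r.vop v * q := by
  rw [reduceVOP_eq]
  exact foldl_localComplementation_vop _ r hac (by rw [List.reverse_reverse, (hD _).2])

theorem Represents.foldl_localComplementation {V : Type*} [Fintype V] [DecidableEq V]
    {ψ : QState V} (l : List V) {r : GraphRegister V} (h : r.Represents ψ) :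
    (l.foldl GraphRegister.localComplementation r).Represents ψ := by
  induction l generalizing r with
  | nil => exact h
  | cons v l ih => exact ih (h.localComplementation v)

theorem Represents.reduceVOP {V : Type*} [Fintype V] [DecidableEq V]
    {D : LocalClifford → List CliffordFactor} {r : GraphRegister V} {ψ : QState V}
    (h : r.Represents ψ) (a c : V) : (r.reduceVOP D a c).Represents ψ :=
  h.foldl_localComplementation _

/-- Reducing a vertex whose operator is already trivial does not change the graph. -/
theorem reduceVOP_graph_of_vop_eq_one {V : Type*} {D : LocalClifford → List CliffordFactor}
    (hD : IsDecompositionTable D) (r : GraphRegister V) {a : V} (ha : r.vop a = 1) (c : V) :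
    (r.reduceVOP D a c).graph = r.graph := by
  have h := map_isNegIX_of_prod_eq_one (hD (r.vop a)).1 ((hD (r.vop a)).2.trans ha)
  have hf : factorCenter a c = (fun t : Bool => if t then a else c) ∘ CliffordFactor.isNegIX := by
    funext f
    cases f <;> rfl
  rw [reduceVOP_eq, hf, ← List.map_map, List.map_reverse]
  -- A nonempty word for the identity complements four times about one vertex, and complementing
  -- twice restores the graph.
  have four : ∀ v : V, ([v, v, v, v].foldl GraphRegister.localComplementation r).graph
      = r.graph := by
    intro v
    change localComplement (localComplement (localComplement (localComplement r.graph v) v) v) v = _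
    rw [localComplement_localComplement, localComplement_localComplement]
  simp only [List.mem_cons, List.not_mem_nil, or_false] at h
  rcases h with h | h | h <;> rw [h]
  · rfl
  · exact four a
  · exact four c

end GraphRegister

end

noncomputable section

/-! ### Table lookup -/

theorem top_eq_edge_fin_two : (⊤ : SimpleGraph (Fin 2)) = SimpleGraph.edge 0 1 := by
  ext v w
  fin_cases v <;> fin_cases w <;> simp [SimpleGraph.edge_adj]

theorem graph_eq_sdiff_sup_edge {V : Type*} (G : SimpleGraph V) {a b : V} (hab : a ≠ b) (e : Bool)
    (he : e = true ↔ G.Adj a b) :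
    G = (G \ SimpleGraph.edge a b) ⊔ (if e then SimpleGraph.edge a b else ⊥) := by
  ext v w
  have h1 : v = a ∧ w = b → (G.Adj v w ↔ G.Adj a b) := by rintro ⟨rfl, rfl⟩; rfl
  have h2 : v = b ∧ w = a → (G.Adj v w ↔ G.Adj a b) := by
    rintro ⟨rfl, rfl⟩; exact G.adj_comm _ _
  have h3 : v = a ∧ w = b → v ≠ w := by rintro ⟨rfl, rfl⟩; exact hab
  have h4 : v = b ∧ w = a → v ≠ w := by rintro ⟨rfl, rfl⟩; exact hab.symm
  cases e <;> simp [SimpleGraph.edge_adj] at he ⊢ <;> tauto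

section Lookup

variable {V : Type*} [Fintype V] [DecidableEq V]

/-- Bits at isolated vertices are irrelevant, so they may be overwritten. -/
theorem graphSign_congr {G : SimpleGraph V} {x y : V → Fin 2}
    (h : ∀ v w, G.Adj v w → x v = y v) : graphSign G x = graphSign G y := by
  classical
  refine Finset.prod_congr rfl fun e he => ?_
  induction e with
  | _ p q =>
    have hpq : G.Adj p q := by simpa using he
    rw [czSign_mk, czSign_mk, h p q hpq, h q p hpq.symm]

theorem graphSign_sup_edge {G : SimpleGraph V} {a b : V} (hab : a ≠ b) (hG : ¬ G.Adj a b)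
    (e : Bool) (x : V → Fin 2) :
    graphSign (G ⊔ if e then SimpleGraph.edge a b else ⊥) x
      = graphSign G x * if e then czSign s(a, b) x else 1 := by
  cases e
  · simp
  · have hd : Disjoint G (SimpleGraph.edge a b) := by
      rw [SimpleGraph.disjoint_left]
      intro v w hvw h
      rcases ((SimpleGraph.edge_adj _ _ _ _).1 h).1 with ⟨rfl, rfl⟩ | ⟨rfl, rfl⟩
      · exact hG hvw
      · exact hG hvw.symm
    simp only [if_true]
    rw [← hd.symmDiff_eq_sup, graphSign_symmDiff, graphSign_edge hab]

theorem graphSign_fin_two (e : Bool) (x : Fin 2 → Fin 2) :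
    graphSign (if e then ⊤ else ⊥ : SimpleGraph (Fin 2)) x
      = if e then czSign s(0, 1) x else 1 := by
  cases e
  · simp [graphSign_bot]
  · simp [top_eq_edge_fin_two, graphSign_edge]

/-- Summation over the values at two vertices splits off if the other factor does not depend on
them. -/
theorem sum_mul_of_independent {a b : V} (hab : a ≠ b) (φ : (Fin 2 → Fin 2) → ℂ)
    {B : (V → Fin 2) → ℂ} (hB : ∀ y y', (∀ v, v ≠ a → v ≠ b → y v = y' v) → B y = B y')
    (i j : Fin 2) :
    ∑ y : V → Fin 2, φ ![y a, y b] * B y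
      = (∑ y ∈ Finset.univ.filter (fun y : V → Fin 2 => y a = i ∧ y b = j), B y)
        * ∑ t, φ t := by
  rw [← Finset.sum_fiberwise Finset.univ (fun y : V → Fin 2 => ![y a, y b]), Finset.mul_sum]
  refine Finset.sum_congr rfl fun t _ => ?_
  have h1 : ∑ y ∈ Finset.univ.filter (fun y : V → Fin 2 => ![y a, y b] = t), φ ![y a, y b] * B y
      = φ t * ∑ y ∈ Finset.univ.filter (fun y : V → Fin 2 => ![y a, y b] = t), B y := by
    rw [Finset.mul_sum]
    refine Finset.sum_congr rfl fun y hy => ?_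
    rw [(Finset.mem_filter.1 hy).2]
  rw [h1, mul_comm]
  congr 1
  -- All fibres over the bits at `a` and `b` have the same sum of `B`: overwriting the two bits is a
  -- bijection between them that `B` does not notice.
  refine Finset.sum_bij' (fun y _ => Function.update (Function.update y a i) b j)
    (fun y _ => Function.update (Function.update y a (t 0)) b (t 1)) ?_ ?_ ?_ ?_ ?_
  · intro y _
    simp [hab]
  · intro y _
    refine Finset.mem_filter.2 ⟨Finset.mem_univ _, ?_⟩
    ext k
    fin_cases k <;> simp [hab]
  · intro y hy
    have ht := (Finset.mem_filter.1 hy).2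
    funext v
    by_cases hb : v = b
    · subst hb
      simp [← ht]
    · by_cases ha : v = a
      · subst ha
        simp [← ht, hb]
      · simp [ha, hb]
  · intro y hy
    obtain ⟨rfl, rfl⟩ := (Finset.mem_filter.1 hy).2
    funext v
    by_cases hb : v = b
    · subst hb
      simp
    · by_cases ha : v = a
      · subst ha
        simp [hb]
      · simp [ha, hb]
  · intro y _
    refine hB _ _ fun v ha hb => ?_
    simp [ha, hb]

/-- The amplitudes of `|G; C⟩` with the vertex operators of `a` and `b` disregarded, in units of the
normalization of a two-qubit graph state. -/
def restAmplitude (G : SimpleGraph V) (C : V → cliffordOps) (a b : V) (x : V → Fin 2) : ℂ :=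
  ∑ y ∈ Finset.univ.filter (fun y : V → Fin 2 => y a = x a ∧ y b = x b),
    (∏ v ∈ (Finset.univ.erase a).erase b, cliffordMat (C v) (x v) (y v))
      * (graphSign G (Function.update (Function.update y a (x a)) b (x b))
        * (((Real.sqrt 2 : ℝ) : ℂ)⁻¹) ^ Fintype.card V * 2)

theorem restAmplitude_congr (G : SimpleGraph V) {C C' : V → cliffordOps} {a b : V}
    (h : ∀ v, v ≠ a → v ≠ b → C v = C' v) (x : V → Fin 2) :
    restAmplitude G C a b x = restAmplitude G C' a b x := by
  refine Finset.sum_congr rfl fun y _ => ?_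
  congr 1
  refine Finset.prod_congr rfl fun v hv => ?_
  have h1 := Finset.mem_erase.1 hv
  rw [h v (Finset.ne_of_mem_erase h1.2) h1.1]

/-- If `a` and `b` have diagonal vertex operators or no further neighbours, then the two-qubit state
on `a` and `b` splits off as a factor of the amplitudes. -/
theorem vopState_sup_edge {G : SimpleGraph V} {a b : V} (hab : a ≠ b) (hG : ¬ G.Adj a b) (e : Bool)
    {C : V → cliffordOps} (ha : (∀ v, ¬ G.Adj a v) ∨ cliffordClass (C a) ∈ zSet)
    (hb : (∀ v, ¬ G.Adj b v) ∨ cliffordClass (C b) ∈ zSet) (x : V → Fin 2) :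
    vopState (G ⊔ if e then SimpleGraph.edge a b else ⊥) C x
      = restAmplitude G C a b x
        * vopState (if e then ⊤ else ⊥ : SimpleGraph (Fin 2)) ![C a, C b] ![x a, x b] := by
  set B : (V → Fin 2) → ℂ := fun y =>
    (∏ v ∈ (Finset.univ.erase a).erase b, cliffordMat (C v) (x v) (y v))
      * (graphSign G (Function.update (Function.update y a (x a)) b (x b))
        * (((Real.sqrt 2 : ℝ) : ℂ)⁻¹) ^ Fintype.card V * 2) with hBdef
  have hB : ∀ y y', (∀ v, v ≠ a → v ≠ b → y v = y' v) → B y = B y' := by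
    intro y y' h
    simp only [hBdef]
    congr 1
    · refine Finset.prod_congr rfl fun v hv => ?_
      have h1 := Finset.mem_erase.1 hv
      rw [h v (Finset.ne_of_mem_erase h1.2) h1.1]
    · congr 3
      funext v
      by_cases hvb : v = b
      · subst hvb
        simp
      · by_cases hva : v = a
        · subst hva
          simp [hvb]
        · simp [hva, hvb, h v hva hvb]
  have hs := sqrt_two_inv_mul_self
  rw [vopState_apply, vopState_apply, restAmplitude,
    ← sum_mul_of_independent hab _ hB (x a) (x b)]
  refine Finset.sum_congr rfl fun y _ => ?_
  rw [graphSign_sup_edge hab hG, graphSign_fin_two, czSign_mk, czSign_mk,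
    ← Finset.mul_prod_erase _ _ (Finset.mem_univ a),
    ← Finset.mul_prod_erase _ _ (Finset.mem_erase.2 ⟨hab.symm, Finset.mem_univ b⟩)]
  simp only [Fin.prod_univ_two, Matrix.cons_val_zero, Matrix.cons_val_one, Fintype.card_fin, hBdef]
  -- In a nonzero term a diagonal VOP forces the bits of `y` and `x` to agree, while an operand
  -- without neighbours in `G` does not affect the sign. Either way the operand bits in the sign of
  -- `G` may be taken from `x`.
  have key : cliffordMat (C a) (x a) (y a) * cliffordMat (C b) (x b) (y b) * graphSign G y
      = cliffordMat (C a) (x a) (y a) * cliffordMat (C b) (x b) (y b)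
        * graphSign G (Function.update (Function.update y a (x a)) b (x b)) := by
    by_cases h1 : cliffordMat (C a) (x a) (y a) = 0
    · simp [h1]
    by_cases h2 : cliffordMat (C b) (x b) (y b) = 0
    · simp [h2]
    congr 1
    refine graphSign_congr fun v w hvw => ?_
    by_cases hvb : v = b
    · subst hvb
      rcases hb with hb | hb
      · exact absurd hvw (hb w)
      · rw [Function.update_self]
        by_contra hne
        exact h2 (cliffordMat_offDiag_of_mem_zSet hb (Ne.symm hne))
    · by_cases hva : v = a
      · subst hva
        rcases ha with ha | ha
        · exact absurd hvw (ha w)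
        · rw [Function.update_of_ne hvb, Function.update_self]
          by_contra hne
          exact h1 (cliffordMat_offDiag_of_mem_zSet ha (Ne.symm hne))
      · simp [hva, hvb]
  generalize (if e = true then czBits (y a) (y b) else 1) = c
  generalize cliffordMat (C a) (x a) (y a) = A at *
  generalize cliffordMat (C b) (x b) (y b) = B' at *
  generalize graphSign G y = g at *
  generalize graphSign G (Function.update (Function.update y a (x a)) b (x b)) = g' at *
  generalize ((Real.sqrt 2 : ℝ) : ℂ)⁻¹ = s at *
  generalize (∏ v ∈ (Finset.univ.erase a).erase b, cliffordMat (C v) (x v) (y v)) = P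
  -- The factor 2 of the rest amplitude cancels the normalization `s² = 1/2` of the two-qubit state.
  linear_combination P * c * s ^ Fintype.card V * key
    - 2 * A * B' * c * P * g' * s ^ Fintype.card V * hs

namespace GraphRegister

theorem Represents.lookupCPhase {T : PhaseTable} (hT : T.IsCorrect) (hTz : T.PreservesZ)
    {r : GraphRegister V} {ψ : QState V} (h : r.Represents ψ) {a b : V} (hab : a ≠ b)
    (hr : r.ReadyForLookup a b) :
    (r.lookupCPhase T a b).Represents (Matrix.mulVec (controlledZ a b) ψ) := by
  classical
  obtain ⟨C, hC⟩ := r.exists_representatives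
  set G₀ := r.graph \ SimpleGraph.edge a b with hG₀
  have hab₀ : ¬ G₀.Adj a b := by simp [hG₀, SimpleGraph.edge_adj, hab]
  set e : Bool := decide (r.graph.Adj a b) with he
  have hG : r.graph = G₀ ⊔ (if e then SimpleGraph.edge a b else ⊥) :=
    graph_eq_sdiff_sup_edge _ hab _ (by simp [he])
  obtain ⟨U₁, hU₁⟩ := cliffordClass_surjective (T e (r.vop a) (r.vop b)).2.1
  obtain ⟨U₂, hU₂⟩ := cliffordClass_surjective (T e (r.vop a) (r.vop b)).2.2
  have hna : r.otherNeighbors a b = ∅ → ∀ v, ¬ G₀.Adj a v := by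
    intro h0 v hv
    have hv' : r.graph.Adj a v := hv.1
    have hvb : v ≠ b := by rintro rfl; exact hab₀ hv
    have : v ∈ r.otherNeighbors a b := ⟨hv', hvb⟩
    rw [h0] at this
    exact this
  have hnb : r.otherNeighbors b a = ∅ → ∀ v, ¬ G₀.Adj b v := by
    intro h0 v hv
    have hv' : r.graph.Adj b v := hv.1
    have hva : v ≠ a := by rintro rfl; exact hab₀ hv.symm
    have : v ∈ r.otherNeighbors b a := ⟨hv', hva⟩
    rw [h0] at this
    exact this
  have hz := hTz e (r.vop a) (r.vop b)
  refine represents_of_eqUpToPhase (C := Function.update (Function.update C a U₁) b U₂) ?_ ?_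
  · intro v
    by_cases hvb : v = b
    · subst hvb
      simp [GraphRegister.lookupCPhase, hU₂, he]
    · by_cases hva : v = a
      · subst hva
        simp [GraphRegister.lookupCPhase, hvb, hU₁, he]
      · simp [GraphRegister.lookupCPhase, hva, hvb, hC]
  · refine ((h C hC).mulVec _).trans ?_
    have h2 := hT e (r.vop a) (r.vop b) (vopState (if e then ⊤ else ⊥) ![C a, C b]) (by
      refine represents_of_eqUpToPhase (C := ![C a, C b]) ?_ ⟨1, by simp, by rw [one_smul]; rfl⟩
      intro v
      fin_cases v <;> simp [twoQubitRegister, hC])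
    obtain ⟨z, hz1, hz2⟩ := h2 ![U₁, U₂] (by
      intro v
      fin_cases v <;> simp [twoQubitRegister, hU₁, hU₂])
    refine ⟨z, hz1, funext fun x => ?_⟩
    have e1 := vopState_sup_edge hab hab₀ e (C := C)
      (hr.1.imp hna fun h => by rw [hC]; exact h) (hr.2.imp hnb fun h => by rw [hC]; exact h) x
    -- Constraint 1 enters here: an operand with further neighbours still has a diagonal VOP, so the
    -- new state factors in the same way.
    have e2 := vopState_sup_edge hab hab₀ (T e (r.vop a) (r.vop b)).1
      (C := Function.update (Function.update C a U₁) b U₂)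
      (hr.1.imp hna fun h => by simpa [hab, hU₁] using hz.1 h)
      (hr.2.imp hnb fun h => by simpa [hU₂] using hz.2 h) x
    have e3 := congrFun hz2 ![x a, x b]
    rw [← hG] at e1
    rw [controlledZ_mulVec, czSign_mk, Pi.smul_apply, smul_eq_mul] at e3
    change _ = z * vopState (G₀ ⊔ if (T e (r.vop a) (r.vop b)).1 then SimpleGraph.edge a b else ⊥)
      _ x
    -- The rest factor sees neither the edge nor the operand VOPs, so it is the same before and
    -- after; only the two-qubit identity `e3` remains.
    rw [controlledZ_mulVec, e1, e2, czSign_mk, 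
      restAmplitude_congr G₀ (C := Function.update (Function.update C a U₁) b U₂) (C' := C)]
    · simp only [Function.update_self, Function.update_of_ne hab]
      simp only [Matrix.cons_val_zero, Matrix.cons_val_one] at e3
      change _ = z * vopState (if (T e (r.vop a) (r.vop b)).1 then ⊤ else ⊥) ![U₁, U₂] _ at e3
      linear_combination restAmplitude G₀ C a b x * e3
    · intro v hva hvb
      simp [hva, hvb]

end GraphRegister

end Lookup

end

noncomputable section

/-! ### Existence of the phase table -/

/-- The diagonal of the Pauli matrix `Z`. -/
def zSign (i : Fin 2) : ℂ := if i = 1 then -1 else 1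

theorem cliffordMat_zOp_mul (U : cliffordOps) (i j : Fin 2) :
    cliffordMat (zOp * U) i j = zSign i * cliffordMat U i j := by
  rw [cliffordMat_mul]
  change (pauliZ * _) i j = _
  fin_cases i <;> simp [pauliZ, zSign, Matrix.mul_apply]

/-- The relation `M X = ε Z M` in entries, using `ε² = 1`: a flip of the input bit is traded for a
sign of the output bit. -/
theorem mul_apply_add_one_of_mul_pauliX {M : QMat} {ε : ℂ} (hε : ε = 1 ∨ ε = -1)
    (h : M * pauliX = ε • pauliZ * M) (i j : Fin 2) :
    ε * M i (j + 1) = zSign i * M i j := by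
  have h' := congrFun (congrFun h i) j
  rcases hε with rfl | rfl <;> fin_cases i <;> fin_cases j <;>
    simp [pauliX, pauliZ, Matrix.mul_apply, zSign] at h' ⊢ <;> simp [h']

section PhaseTable

variable {V : Type*} [Fintype V] [DecidableEq V]

theorem vopState_update_zOp_mul (G : SimpleGraph V) (C : V → cliffordOps) (b : V)
    (x : V → Fin 2) :
    vopState G (Function.update C b (zOp * C b)) x = zSign (x b) * vopState G C x := by
  rw [vopState_apply, vopState_apply, Finset.mul_sum]
  refine Finset.sum_congr rfl fun y _ => ?_
  rw [← mul_assoc (zSign (x b))]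
  congr 1
  rw [← Finset.mul_prod_erase _ _ (Finset.mem_univ b),
    ← Finset.mul_prod_erase _ (fun v => cliffordMat (C v) (x v) (y v)) (Finset.mem_univ b),
    Function.update_self, cliffordMat_zOp_mul, mul_assoc]
  congr 2
  refine Finset.prod_congr rfl fun v hv => ?_
  rw [Function.update_of_ne (Finset.ne_of_mem_erase hv)]

/-- If `C_a X C_a† = ±Z` and `a` has no neighbour but possibly `b`, with `C_b` diagonal, then the
correlation operator of `a` becomes a relation between `Z_a` and `Z_b` on the state. -/
theorem zSign_mul_vopState (G : SimpleGraph V) {C : V → cliffordOps} {a b : V} {ε : ℂ}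
    (hε : ε = 1 ∨ ε = -1)
    (hM : cliffordMat (C a) * pauliX = ε • pauliZ * cliffordMat (C a))
    (hN : ∀ v, G.Adj a v → v = b ∧ cliffordClass (C b) ∈ zSet) (x : V → Fin 2) :
    zSign (x a) * vopState G C x
      = ε * (open Classical in if G.Adj a b then zSign (x b) else 1) * vopState G C x := by
  classical
  have hflip : Function.Involutive fun y : V → Fin 2 => Function.update y a (y a + 1) := by
    intro y
    have h : ∀ i : Fin 2, i + 1 + 1 = i := by decide
    simp [h]
  have hprod : ∀ y : V → Fin 2, zSign (x a) * ∏ v, cliffordMat (C v) (x v) (y v)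
      = ε * ∏ v, cliffordMat (C v) (x v) (Function.update y a (y a + 1) v) := by
    intro y
    rw [← Finset.mul_prod_erase _ _ (Finset.mem_univ a),
      ← Finset.mul_prod_erase _ (fun v => cliffordMat (C v) (x v) (Function.update y a (y a + 1) v))
        (Finset.mem_univ a), Function.update_self, ← mul_assoc, ← mul_assoc,
      mul_apply_add_one_of_mul_pauliX hε hM]
    congr 1
    refine Finset.prod_congr rfl fun v hv => ?_
    rw [Function.update_of_ne (Finset.ne_of_mem_erase hv)]
  have hsgn : ∀ y : V → Fin 2, (∏ v, if G.Adj a v ∧ y v = 1 then (-1 : ℂ) else 1)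
      = if G.Adj a b then zSign (y b) else 1 := by
    intro y
    rw [Finset.prod_eq_single b]
    · by_cases h : G.Adj a b <;> simp [h, zSign]
    · intro v _ hv
      rw [if_neg fun h => hv (hN v h.1).1]
    · simp
  rw [vopState_apply, Finset.mul_sum, Finset.mul_sum]
  simp only [← mul_assoc, hprod]
  -- Flipping the summed bit at `a` undoes the flip in the VOP factor and produces the signs of the
  -- neighbours of `a`, at most that of `b`.
  rw [← Equiv.sum_comp (Function.Involutive.toPerm _ hflip)]
  refine Finset.sum_congr rfl fun y _ => ?_
  have h1 : Function.Involutive.toPerm _ hflip y = Function.update y a (y a + 1) := rfl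
  have h2 := hflip y
  simp only [h1] at h2 ⊢
  rw [h2, graphSign_update, hsgn]
  by_cases h : G.Adj a b
  · by_cases hxy : x b = y b
    · simp only [h, if_true, hxy]
      ring
    · rw [Finset.prod_eq_zero (Finset.mem_univ b)
        (cliffordMat_offDiag_of_mem_zSet (hN b h).2 hxy)]
      simp
  · simp only [h, if_false]
    ring

namespace GraphRegister

/-- The register `r'` represents the outcome of the phase gate on `a`, `b` whenever `r` represents
its input. -/
def PhaseGateMaps (a b : V) (r r' : GraphRegister V) : Prop :=
  ∀ ψ, r.Represents ψ → r'.Represents (Matrix.mulVec (controlledZ a b) ψ)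

theorem PhaseGateMaps.of_represents {a b : V} {r r₁ r' : GraphRegister V}
    (h : ∀ ψ, r.Represents ψ → r₁.Represents ψ) (h' : PhaseGateMaps a b r₁ r') :
    PhaseGateMaps a b r r' :=
  fun ψ hψ => h' ψ (h ψ hψ)

theorem PhaseGateMaps.swap {a b : V} {r r' : GraphRegister V} (h : PhaseGateMaps a b r r') :
    PhaseGateMaps b a r r' := by
  intro ψ hψ
  rw [controlledZ_comm]
  exact h ψ hψ

/-- The stabilizer equation says `Z_a = ε` or `Z_a = ε Z_b` on the state. On its support the bit at
`a` is therefore constant, or equal to the bit at `b`, or opposite to it. So the gate acts as `I` or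
as `Z_b`, which is absorbed into the VOP of `b` from the left. -/
theorem exists_phaseGateMaps_of_mapsXToZ (r : GraphRegister V) {a b : V} (hab : a ≠ b)
    (ha : MapsXToZ (r.vop a)) (hN : ∀ v, r.graph.Adj a v → v = b ∧ r.vop b ∈ zSet) :
    ∃ q ∈ zSet, PhaseGateMaps a b r ⟨r.graph, Function.update r.vop b (q * r.vop b)⟩ := by
  classical
  obtain ⟨U, hU, ε, hε, hM⟩ := ha
  obtain ⟨C₀, hC₀⟩ := r.exists_representatives
  obtain ⟨C, hC, hCa⟩ : ∃ C : V → cliffordOps, (∀ v, cliffordClass (C v) = r.vop v) ∧ C a = U := by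
    refine ⟨Function.update C₀ a U, fun v => ?_, by simp⟩
    by_cases hv : v = a
    · subst hv
      simp [hU]
    · simp [hv, hC₀]
  have hst := zSign_mul_vopState r.graph (C := C) (b := b) hε (by rw [hCa]; exact hM)
    (by simpa only [hC] using hN)
  have key : ∀ W : cliffordOps, (∀ x, czBits (x a) (x b) * vopState r.graph C x
        = vopState r.graph (Function.update C b (W * C b)) x) →
      PhaseGateMaps a b r
        ⟨r.graph, Function.update r.vop b (cliffordClass W * r.vop b)⟩ := by
    intro W hW ψ hψ
    refine represents_of_eqUpToPhase (C := Function.update C b (W * C b)) ?_ ?_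
    · intro v
      by_cases hv : v = b
      · subst hv
        simp [cliffordClass_mul, hC]
      · simp [hv, hC]
    · refine ((hψ C hC).mulVec _).trans ⟨1, by simp, ?_⟩
      rw [one_smul]
      funext x
      rw [controlledZ_mulVec, czSign_mk, hW]
  have hcase : (∀ x, czBits (x a) (x b) * vopState r.graph C x = vopState r.graph C x) ∨
      ∀ x, czBits (x a) (x b) * vopState r.graph C x = zSign (x b) * vopState r.graph C x := by
    have aux : ∀ ψ : QState V, ∀ (P : Prop) [Decidable P],
        (∀ x, zSign (x a) * ψ x = ε * (if P then zSign (x b) else 1) * ψ x) →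
        (∀ x, czBits (x a) (x b) * ψ x = ψ x) ∨
        ∀ x, czBits (x a) (x b) * ψ x = zSign (x b) * ψ x := by
      intro ψ P _ h
      have fin2 : ∀ i : Fin 2, i = 0 ∨ i = 1 := by decide
      rcases hε with rfl | rfl <;> by_cases hP : P <;> simp only [hP, if_true, if_false] at h
      · right
        intro x
        have := h x
        rcases fin2 (x a) with h1 | h1 <;> rcases fin2 (x b) with h2 | h2 <;>
          (simp [zSign, czBits, h1, h2] at this ⊢; try grind)
      · left
        intro x
        have := h x
        rcases fin2 (x a) with h1 | h1 <;> rcases fin2 (x b) with h2 | h2 <;>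
          (simp [zSign, czBits, h1, h2] at this ⊢; try grind)
      · left
        intro x
        have := h x
        rcases fin2 (x a) with h1 | h1 <;> rcases fin2 (x b) with h2 | h2 <;>
          (simp [zSign, czBits, h1, h2] at this ⊢; try grind)
      · right
        intro x
        have := h x
        rcases fin2 (x a) with h1 | h1 <;> rcases fin2 (x b) with h2 | h2 <;>
          (simp [zSign, czBits, h1, h2] at this ⊢; try grind)
    exact aux _ _ hst
  rcases hcase with h | h
  · exact ⟨1, one_mem_zSet, key 1 fun x => by rw [h, one_mul, Function.update_eq_self]⟩
  · exact ⟨_, class_zOp_mem_zSet, key zOp fun x => by rw [h, vopState_update_zOp_mul]⟩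

/-- Local complementations about `a` bring its vertex operator to `𝒵` or to a form that maps `X` to
`±Z`. -/
theorem exists_mapsXToZ_or_mem_zSet (r : GraphRegister V) (a : V) :
    ∃ r' : GraphRegister V, (∀ ψ, r.Represents ψ → r'.Represents ψ) ∧
      (MapsXToZ (r'.vop a) ∨ r'.vop a ∈ zSet) ∧
      (∀ v, v ≠ a → ∃ q ∈ zSet, r'.vop v = r.vop v * q) ∧
      ∀ v, r'.graph.Adj a v ↔ r.graph.Adj a v := by
  have iter : ∀ k : ℕ, ∃ r' : GraphRegister V, (∀ ψ, r.Represents ψ → r'.Represents ψ) ∧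
      r'.vop a = r.vop a * sqrtIX ^ k ∧
      (∀ v, v ≠ a → ∃ q ∈ zSet, r'.vop v = r.vop v * q) ∧
      ∀ v, r'.graph.Adj a v ↔ r.graph.Adj a v := by
    intro k
    induction k with
    | zero => exact ⟨r, fun _ h => h, by simp, fun v _ => ⟨1, one_mem_zSet, by simp⟩,
        fun _ => Iff.rfl⟩
    | succ k ih =>
      obtain ⟨r', h1, h2, h3, h4⟩ := ih
      refine ⟨r'.localComplementation a, fun ψ h => (h1 ψ h).localComplementation a, ?_, ?_, ?_⟩
      · rw [localComplementation_vop_self, h2, pow_succ, mul_assoc]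
      · intro v hv
        obtain ⟨q, hq, e⟩ := h3 v hv
        obtain ⟨q', hq', e'⟩ := r'.localComplementation_vop_of_ne hv
        exact ⟨q * q', mul_mem_zSet hq hq', by rw [e', e, mul_assoc]⟩
      · intro v
        rw [localComplementation_adj_self, h4]
  rcases mapsXToZ_or_exists_mul_sqrtIX_pow (r.vop a) with h | ⟨k, hk⟩
  · exact ⟨r, fun _ h => h, Or.inl h, fun v _ => ⟨1, one_mem_zSet, by simp⟩, fun _ => Iff.rfl⟩
  · obtain ⟨r', h1, h2, h3, h4⟩ := iter k
    exact ⟨r', h1, Or.inr (h2 ▸ hk), h3, h4⟩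

/-- Complementing about `b` keeps `C_a` diagonal and makes `C_b` either diagonal, so that toggling
works, or of the kind sending X to `±Z`, where the stabilizer equation of `b` applies. A `C_b` that
is diagonal at the outset is treated separately so as to respect `𝒵`. -/
theorem exists_phaseGateMaps_of_mem_zSet (r : GraphRegister V) {a b : V} (hab : a ≠ b)
    (ha : r.vop a ∈ zSet) (hb : ∀ v, r.graph.Adj b v → v = a) :
    ∃ r', PhaseGateMaps a b r r' ∧ r'.vop a ∈ zSet ∧ (r.vop b ∈ zSet → r'.vop b ∈ zSet) := by
  by_cases hbz : r.vop b ∈ zSet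
  · exact ⟨r.toggleEdge a b, fun ψ h => h.toggleEdge hab ha hbz, ha, fun h => h⟩
  obtain ⟨r₁, h1, h2, h3, h4⟩ := r.exists_mapsXToZ_or_mem_zSet b
  obtain ⟨q, hq, e⟩ := h3 a hab
  have ha₁ : r₁.vop a ∈ zSet := by rw [e]; exact mul_mem_zSet ha hq
  rcases h2 with h2 | h2
  · obtain ⟨p, hp, hm⟩ := r₁.exists_phaseGateMaps_of_mapsXToZ hab.symm h2
      fun v hv => ⟨hb v ((h4 v).1 hv), ha₁⟩
    refine ⟨_, hm.swap.of_represents h1, ?_, fun h => absurd h hbz⟩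
    simpa using mul_mem_zSet hp ha₁
  · exact ⟨r₁.toggleEdge a b, PhaseGateMaps.of_represents h1 fun ψ h => h.toggleEdge hab ha₁ h2,
      ha₁, fun h => absurd h hbz⟩

/-- On two qubits, the phase gate can be described by a change of the register that respects `𝒵`. -/
theorem exists_phaseGateMaps (r : GraphRegister V) {a b : V} (hab : a ≠ b)
    (hV : ∀ v, v = a ∨ v = b) :
    ∃ r', PhaseGateMaps a b r r' ∧ (r.vop a ∈ zSet → r'.vop a ∈ zSet) ∧
      (r.vop b ∈ zSet → r'.vop b ∈ zSet) := by
  have hNa : ∀ (r : GraphRegister V) v, r.graph.Adj a v → v = b := fun r v hv =>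
    (hV v).resolve_left hv.ne'
  have hNb : ∀ (r : GraphRegister V) v, r.graph.Adj b v → v = a := fun r v hv =>
    (hV v).resolve_right hv.ne'
  by_cases haz : r.vop a ∈ zSet
  · obtain ⟨r', h, h1, h2⟩ := r.exists_phaseGateMaps_of_mem_zSet hab haz (hNb r)
    exact ⟨r', h, fun _ => h1, h2⟩
  by_cases hbz : r.vop b ∈ zSet
  · obtain ⟨r', h, h1, h2⟩ := r.exists_phaseGateMaps_of_mem_zSet hab.symm hbz (hNa r)
    exact ⟨r', h.swap, h2, fun _ => h1⟩
  -- With neither VOP in `𝒵`, Constraint 1 is vacuous. If there is an edge, `b` itself may serve as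
  -- swapping partner; if not, the stabilizer equation of `a` makes no demand on `C_b`.
  suffices ∃ r', PhaseGateMaps a b r r' by
    obtain ⟨r', h⟩ := this
    exact ⟨r', h, fun h => absurd h haz, fun h => absurd h hbz⟩
  by_cases hadj : r.graph.Adj a b
  · obtain ⟨D, hD⟩ := exists_isDecompositionTable
    have h1 : (r.reduceVOP D a b).vop a ∈ zSet := by
      rw [(r.reduceVOP_vop hD hadj).1]
      exact one_mem_zSet
    obtain ⟨r', h, -⟩ := (r.reduceVOP D a b).exists_phaseGateMaps_of_mem_zSet hab h1 (hNb _)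
    exact ⟨r', h.of_represents fun ψ hψ => hψ.reduceVOP a b⟩
  · obtain ⟨r₁, h1, h2, -, h4⟩ := r.exists_mapsXToZ_or_mem_zSet a
    rcases h2 with h2 | h2
    · obtain ⟨q, -, h⟩ := r₁.exists_phaseGateMaps_of_mapsXToZ hab h2 fun v hv =>
        absurd (hNa r₁ v hv ▸ (h4 v).1 hv) hadj
      exact ⟨_, h.of_represents h1⟩
    · obtain ⟨r', h, -⟩ := r₁.exists_phaseGateMaps_of_mem_zSet hab h2 (hNb _)
      exact ⟨r', h.of_represents h1⟩

theorem exists_eq_twoQubitRegister (r : GraphRegister (Fin 2)) :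
    ∃ e, r = twoQubitRegister e (r.vop 0) (r.vop 1) := by
  classical
  refine ⟨decide (r.graph.Adj 0 1), ?_⟩
  obtain ⟨G, C⟩ := r
  simp only [twoQubitRegister, GraphRegister.mk.injEq]
  constructor
  · have h := G.adj_comm 0 1
    by_cases h' : G.Adj 0 1 <;> ext v w <;> fin_cases v <;> fin_cases w <;> simp_all
  · funext v
    fin_cases v <;> rfl

end GraphRegister

end PhaseTable

theorem exists_phaseTable : ∃ T : PhaseTable, T.IsCorrect ∧ T.PreservesZ := by
  have h : ∀ (e : Bool) (C₁ C₂ : LocalClifford), ∃ t : Bool × LocalClifford × LocalClifford,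
      GraphRegister.PhaseGateMaps 0 1 (twoQubitRegister e C₁ C₂)
        (twoQubitRegister t.1 t.2.1 t.2.2) ∧
      (C₁ ∈ zSet → t.2.1 ∈ zSet) ∧ (C₂ ∈ zSet → t.2.2 ∈ zSet) := by
    intro e C₁ C₂
    obtain ⟨r', h1, h2, h3⟩ := (twoQubitRegister e C₁ C₂).exists_phaseGateMaps
      (a := 0) (b := 1) (by decide) (by decide)
    obtain ⟨e', he'⟩ := r'.exists_eq_twoQubitRegister
    exact ⟨(e', r'.vop 0, r'.vop 1), he' ▸ h1, h2, h3⟩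
  choose T hT using h
  exact ⟨T, fun e C₁ C₂ => (hT e C₁ C₂).1, fun e C₁ C₂ => (hT e C₁ C₂).2⟩

end

noncomputable section

/-! ### The procedure `cphase` -/

namespace GraphRegister

section

variable {V : Type*} {D : LocalClifford → List CliffordFactor}

/-- The guard excludes the fallback partner `b`, so every partner used is a non-operand. -/
theorem tryRemoveVOP_iff {a b : V} {r r' : GraphRegister V} :
    TryRemoveVOP D a b r r' ↔
      (∃ c ∈ r.otherNeighbors a b, r' = r.reduceVOP D a c) ∨
        r.otherNeighbors a b = ∅ ∧ r' = r := by
  unfold TryRemoveVOP RemoveVOP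
  refine or_congr_left ⟨?_, ?_⟩
  · rintro ⟨hne, c, ⟨-, hc⟩ | ⟨h0, -⟩, rfl⟩
    · exact ⟨c, hc, rfl⟩
    · exact absurd h0 hne.ne_empty
  · rintro ⟨c, hc, rfl⟩
    exact ⟨⟨c, hc⟩, c, Or.inl ⟨⟨c, hc⟩, hc⟩, rfl⟩

theorem exists_tryRemoveVOP (a b : V) (r : GraphRegister V) :
    ∃ r', TryRemoveVOP D a b r r' := by
  simp only [tryRemoveVOP_iff]
  rcases (r.otherNeighbors a b).eq_empty_or_nonempty with h | ⟨c, hc⟩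
  · exact ⟨r, Or.inr ⟨h, rfl⟩⟩
  · exact ⟨_, Or.inl ⟨c, hc, rfl⟩⟩

theorem exists_cPhase (T : PhaseTable) (a b : V) (r : GraphRegister V) :
    ∃ r', CPhase D T a b r r' := by
  obtain ⟨r₁, h₁⟩ := exists_tryRemoveVOP (D := D) a b r
  obtain ⟨r₂, h₂⟩ := exists_tryRemoveVOP (D := D) b a r₁
  obtain ⟨r₃, h₃⟩ := exists_tryRemoveVOP (D := D) a b r₂
  exact ⟨_, r₃, ⟨r₁, r₂, h₁, h₂, h₃⟩, rfl⟩

theorem reduceVOP_vop_mem_zSet (hD : IsDecompositionTable D) {r : GraphRegister V} {a b c : V}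
    (hab : a ≠ b) (hc : c ∈ r.otherNeighbors a b) (hb : r.vop b ∈ zSet) :
    (r.reduceVOP D a c).vop b ∈ zSet := by
  obtain ⟨q, hq, e⟩ := (r.reduceVOP_vop hD hc.1).2.2 b hab.symm (Ne.symm hc.2)
  rw [e]
  exact mul_mem_zSet hb hq

/-- If `b` was reduced, its VOP stays in `𝒵` during the last step, which in turn settles `a`, even
if reducing `b` gave `a` new neighbours. If `b` was skipped, it must be shown that the last step
gives it no new neighbour. -/
theorem PrepareCPhase.readyForLookup (hD : IsDecompositionTable D) {a b : V} (hab : a ≠ b)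
    {r r' : GraphRegister V} (h : PrepareCPhase D a b r r') : r'.ReadyForLookup a b := by
  obtain ⟨r₁, r₂, h₁, h₂, h₃⟩ := h
  rw [tryRemoveVOP_iff] at h₁ h₂ h₃
  have hone : ∀ (s : GraphRegister V) {v w c : V}, c ∈ s.otherNeighbors v w →
      (s.reduceVOP D v c).vop v ∈ zSet := by
    intro s v w c hc
    rw [(s.reduceVOP_vop hD hc.1).1]
    exact one_mem_zSet
  rcases h₂ with ⟨d, hd, rfl⟩ | ⟨h0, rfl⟩
  · have hb := hone _ hd
    rcases h₃ with ⟨c, hc, rfl⟩ | ⟨h0, rfl⟩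
    · exact ⟨Or.inr (hone _ hc), Or.inr (reduceVOP_vop_mem_zSet hD hab hc hb)⟩
    · exact ⟨Or.inl h0, Or.inr hb⟩
  · rcases h₃ with ⟨c, hc, rfl⟩ | ⟨h0', rfl⟩
    · refine ⟨Or.inr (hone _ hc), Or.inl ?_⟩
      -- Step (2) changed nothing, and `a` has a non-operand neighbour now, so it was reduced in
      -- step (1). Reducing it again leaves the graph as it is.
      have h1 : r₂.vop a = 1 := by
        rcases h₁ with ⟨c', hc', rfl⟩ | ⟨h0', rfl⟩
        · exact (r.reduceVOP_vop hD hc'.1).1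
        · rw [h0'] at hc
          exact hc.elim
      unfold otherNeighbors
      rw [reduceVOP_graph_of_vop_eq_one hD _ h1]
      exact h0
    · exact ⟨Or.inl h0', Or.inl h0⟩

end

section

variable {V : Type*} [Fintype V] [DecidableEq V] {D : LocalClifford → List CliffordFactor}

theorem Represents.tryRemoveVOP {a b : V} {r r' : GraphRegister V} {ψ : QState V}
    (hr : r.Represents ψ) (h : TryRemoveVOP D a b r r') : r'.Represents ψ := by
  rcases tryRemoveVOP_iff.1 h with ⟨c, -, rfl⟩ | ⟨-, rfl⟩
  · exact hr.reduceVOP a c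
  · exact hr

theorem Represents.prepareCPhase {a b : V} {r r' : GraphRegister V} {ψ : QState V}
    (hr : r.Represents ψ) (h : PrepareCPhase D a b r r') : r'.Represents ψ := by
  obtain ⟨r₁, r₂, h₁, h₂, h₃⟩ := h
  exact ((hr.tryRemoveVOP h₁).tryRemoveVOP h₂).tryRemoveVOP h₃

end

end GraphRegister

end

theorem mainTheorem1 :
    -- every local Clifford operator is a product of at most 5 factors `√(-iX)`, `√(iZ)`
    (∃ D, IsDecompositionTable D) ∧
    -- the two-qubit table exists and can be chosen so that VOPs in `𝒵` stay in `𝒵`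
    (∃ T : PhaseTable, T.IsCorrect ∧ T.PreservesZ) ∧
    -- with any such tables, for any register and any two distinct operand vertices
    ∀ (D : LocalClifford → List CliffordFactor) (T : PhaseTable),
      IsDecompositionTable D → T.IsCorrect → T.PreservesZ →
    ∀ (V : Type*) [Fintype V] [DecidableEq V] (a b : V), a ≠ b →
    ∀ (r : GraphRegister V) (ψ : QState V), r.Represents ψ →
      -- both VOPs in `𝒵`: toggle the edge
      (r.vop a ∈ zSet → r.vop b ∈ zSet →
        (r.toggleEdge a b).Represents (Matrix.mulVec (controlledZ a b) ψ)) ∧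
      -- reduction of the VOP of `a` by means of a neighbour `c`
      (∀ c, r.graph.Adj a c →
        (r.reductionCenters D a c).length ≤ 5 ∧
        (r.reduceVOP D a c).Represents ψ ∧
        (r.reduceVOP D a c).vop a = 1 ∧
        (r.reduceVOP D a c).graph.Adj a c ∧
        ∀ v, v ≠ a → v ≠ c → ∃ q ∈ zSet, (r.reduceVOP D a c).vop v = r.vop v * q) ∧
      -- both VOPs can be reduced with non-operand partners: reduce, then toggle the edge
      (∀ c ∈ r.otherNeighbors a b, ∀ d ∈ (r.reduceVOP D a c).otherNeighbors b a,
        ((r.reduceVOP D a c).reduceVOP D b d).vop a ∈ zSet ∧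
        ((r.reduceVOP D a c).reduceVOP D b d).vop b = 1 ∧
        (((r.reduceVOP D a c).reduceVOP D b d).toggleEdge a b).Represents
          (Matrix.mulVec (controlledZ a b) ψ)) ∧
      -- table lookup
      (r.ReadyForLookup a b →
        (r.lookupCPhase T a b).Represents (Matrix.mulVec (controlledZ a b) ψ)) ∧
      -- the complete procedure `cphase`, for all choices of swapping partners
      (∃ r', GraphRegister.CPhase D T a b r r') ∧
      (∀ r', GraphRegister.PrepareCPhase D a b r r' →
        r'.Represents ψ ∧ r'.ReadyForLookup a b) ∧
      (∀ r', GraphRegister.CPhase D T a b r r' →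
        r'.Represents (Matrix.mulVec (controlledZ a b) ψ)) := by
  refine ⟨exists_isDecompositionTable, exists_phaseTable, ?_⟩
  intro D T hD hT hTz V _ _ a b hab r ψ hr
  refine ⟨fun ha hb => hr.toggleEdge hab ha hb, ?_, ?_,
    fun h => hr.lookupCPhase hT hTz hab h, GraphRegister.exists_cPhase T a b r,
    fun r' h => ⟨hr.prepareCPhase h, h.readyForLookup hD hab⟩, ?_⟩
  · intro c hac
    refine ⟨?_, hr.reduceVOP a c, r.reduceVOP_vop hD hac⟩
    simpa [GraphRegister.reductionCenters] using (hD (r.vop a)).1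
  · intro c hc d hd
    have ha : ((r.reduceVOP D a c).reduceVOP D b d).vop a ∈ zSet := by
      -- As `d ≠ a`, reducing `b` only multiplies the VOP `I` of `a` by an element of `𝒵`.
      refine GraphRegister.reduceVOP_vop_mem_zSet hD hab.symm hd ?_
      rw [(r.reduceVOP_vop hD hc.1).1]
      exact one_mem_zSet
    have hb := ((r.reduceVOP D a c).reduceVOP_vop hD hd.1).1
    exact ⟨ha, hb, ((hr.reduceVOP a c).reduceVOP b d).toggleEdge hab ha (hb ▸ one_mem_zSet)⟩
  · rintro r' ⟨r₁, h₁, rfl⟩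
    exact (hr.prepareCPhase h₁).lookupCPhase hT hTz hab (h₁.readyForLookup hD hab)
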